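/- Let $(G,H,\alpha,\tau)$ be a Lie crossed module: $G,H$ are Lie groups, $\tau:H\to G$ is a smooth homomorphism and $\alpha:G\to\mathrm{Aut}(H)$ a homomorphism with $(g,h)\mapsto\alpha(g)h$ smooth, such that $\tau(\alpha(g)h)=g\tau(h)g^{-1}$ and $\alpha(\tau(h))h'=hh'h^{-1}$. Let $\pi:P\to M$ be a smooth principal $G$-bundle (with $G$ acting on the right of $P$), let $A$ and $\overline A$ be connection forms on it, and let $B$ be a smooth $L(H)$-valued $2$-form on $P$ that is $\alpha$-equivariant, $B_{pg}(vg,wg)=\alpha(g^{-1})B_p(v,w)$, and satisfies $B(v,w)=0$ whenever $\pi_*v=0$. For an $\overline A$-horizontal path $\tilde\gamma:[t_0,t_1]\to P$ and a vector field $\tilde v$ along $\tilde\gamma$ put $$\omega_{(A,B)}(\tilde v)=A\bigl(\tilde v(t_0)\bigr)+\tau\Bigl[\int_{t_0}^{t_1}B\bigl(\tilde\gamma'(t),\tilde v(t)\bigr)\,dt\Bigr]\in L(G),$$ where $\tau$ and $\alpha(g^{-1})$ also denote the derivatives at the identity. For a $C^\infty$ map $\Gamma:[s_0,s_1]\times[t_0,t_1]\to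 M$, $(u,v)\mapsto\Gamma_u(v)$, an $\omega_{(A,B)}$-horizontal lift of $u\mapsto\Gamma_u$ is a $C^\infty$ map $\tilde\Gamma:[s_0,s_1]\times[t_0,t_1]\to P$ with $\pi\circ\tilde\Gamma=\Gamma$ such that every path $\tilde\Gamma_u=\tilde\Gamma(u,\cdot)$ is $\overline A$-horizontal and $\omega_{(A,B)}\bigl(\partial_u\tilde\Gamma(u,\cdot)\bigr)=0$ for every $u\in[s_0,s_1]$. Let $s_0<s_1$, $t_0<t_1$, and let $\Gamma:[s_0,s_1]\times[t_0,t_1]\to M$ be a $C^\infty$ map such that $\partial_u\Gamma$ and $\partial_v\Gamma$ are linearly dependent at each point and $\Gamma(u,t_i)=\Gamma(s_0,t_i)$ for all $u\in[s_0,s_1]$ and $i\in\{0,1\}$. Let $\tilde\Gamma_0:[t_0,t_1]\to P$ be any $C^\infty$ $\overline A$-horizontal path that projects to $\Gamma_{s_0}$. For each $u\in[s_0,s_1]$ let $\tilde\Gamma_u:[t_0,t_1]\to P$ be the (existing and unique) $\overline A$-horizontal lift of $\Gamma_u$ with initial point $\tilde\Gamma_u(t_0)=\tilde\Gamma_0(t_0)$,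 and let $\tilde\Gamma(u,v)=\tilde\Gamma_u(v)$. Then: 1. $\tilde\Gamma$ is $C^\infty$ on $[s_0,s_1]\times[t_0,t_1]$, and $u\mapsto\tilde\Gamma_u$ is the unique $\omega_{(A,B)}$-horizontal lift of $u\mapsto\Gamma_u$ with $\tilde\Gamma_{s_0}=\tilde\Gamma_0$. 2. $\partial_u\tilde\Gamma$ and $\partial_v\tilde\Gamma$ are linearly dependent at each point of $[s_0,s_1]\times[t_0,t_1]$, and $\tilde\Gamma$ keeps the end points fixed: $\tilde\Gamma(u,t_i)=\tilde\Gamma_0(t_i)$ for all $u\in[s_0,s_1]$ and $i\in\{0,1\}$. -/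

import Mathlib

open Set
open scoped Manifold ContDiff RightActions

noncomputable section

namespace PathConn

section Group

variable {EG : Type*} [NormedAddCommGroup EG] [NormedSpace ℝ EG]
  {G : Type*} [TopologicalSpace G] [ChartedSpace EG G] [Group G]
  {EH : Type*} [NormedAddCommGroup EH] [NormedSpace ℝ EH]
  {H : Type*} [TopologicalSpace H] [ChartedSpace EH H] [Group H]

/-- The differential at the identity `L(G) → L(H)` of a group homomorphism `f : G → H`
(the tangent spaces of `H` at `f 1` and at `1` coincide, as `f 1 = 1`). -/
def lieMap (f : G →* H) : GroupLieAlgebra 𝓘(ℝ, EG) G →L[ℝ] GroupLieAlgebra 𝓘(ℝ, EH) H :=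
  mfderiv 𝓘(ℝ, EG) 𝓘(ℝ, EH) f 1

/-- The adjoint representation: `Ad g` is the differential at `1` of `x ↦ g * x * g⁻¹`. -/
def Ad (g : G) : GroupLieAlgebra 𝓘(ℝ, EG) G →L[ℝ] GroupLieAlgebra 𝓘(ℝ, EG) G :=
  lieMap (MulAut.conj g).toMonoidHom

/-- `(G, H, α, τ)` is a Lie crossed module. -/
structure IsLieCrossedModule (EG EH : Type*)
    [NormedAddCommGroup EG] [NormedSpace ℝ EG] [NormedAddCommGroup EH] [NormedSpace ℝ EH]
    {G : Type*} [TopologicalSpace G] [ChartedSpace EG G] [Group G]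
    {H : Type*} [TopologicalSpace H] [ChartedSpace EH H] [Group H]
    (α : G →* MulAut H) (τ : H →* G) : Prop where
  smooth_τ : ContMDiff 𝓘(ℝ, EH) 𝓘(ℝ, EG) ∞ τ
  smooth_α : ContMDiff (𝓘(ℝ, EG).prod 𝓘(ℝ, EH)) 𝓘(ℝ, EH) ∞ (fun x : G × H => α x.1 x.2)
  equivariant : ∀ g h, τ (α g h) = g * τ h * g⁻¹
  peiffer : ∀ h h', α (τ h) h' = h * h' * h⁻¹

end Group

/-- `π : P → M` is a smooth principal `G`-bundle; the right action of `G` on `P` is written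
`p <• g`. -/
structure IsPrincipalBundle (EG EM EP : Type*)
    [NormedAddCommGroup EG] [NormedSpace ℝ EG]
    [NormedAddCommGroup EM] [NormedSpace ℝ EM] [NormedAddCommGroup EP] [NormedSpace ℝ EP]
    (G : Type*) [TopologicalSpace G] [ChartedSpace EG G] [Group G]
    {M : Type*} [TopologicalSpace M] [ChartedSpace EM M]
    {P : Type*} [TopologicalSpace P] [ChartedSpace EP P] [MulAction Gᵐᵒᵖ P]
    (π : P → M) : Prop where
  smooth_proj : ContMDiff 𝓘(ℝ, EP) 𝓘(ℝ, EM) ∞ π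
  surjective : Function.Surjective π
  smooth_act : ContMDiff (𝓘(ℝ, EP).prod 𝓘(ℝ, EG)) 𝓘(ℝ, EP) ∞ (fun x : P × G => x.1 <• x.2)
  free : ∀ (p : P) (g : G), p <• g = p → g = 1
  proj_act : ∀ (p : P) (g : G), π (p <• g) = π p
  locally_trivial : ∀ x : M, ∃ U : Set M, IsOpen U ∧ x ∈ U ∧
    ∃ φ : OpenPartialHomeomorph (M × G) P,
      φ.source = U ×ˢ univ ∧ φ.target = π ⁻¹' U ∧
      ContMDiffOn (𝓘(ℝ, EM).prod 𝓘(ℝ, EG)) 𝓘(ℝ, EP) ∞ φ φ.source ∧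
      ContMDiffOn 𝓘(ℝ, EP) (𝓘(ℝ, EM).prod 𝓘(ℝ, EG)) ∞ φ.symm φ.target ∧
      ∀ u ∈ U, ∀ g h : G, φ (u, g) <• h = φ (u, g * h) ∧ π (φ (u, g)) = u

section Bundle

variable {EG : Type*} [NormedAddCommGroup EG] [NormedSpace ℝ EG]
  {G : Type*} [TopologicalSpace G] [ChartedSpace EG G] [Group G]
  {EH : Type*} [NormedAddCommGroup EH] [NormedSpace ℝ EH]
  {H : Type*} [TopologicalSpace H] [ChartedSpace EH H] [Group H]
  {EM : Type*} [NormedAddCommGroup EM] [NormedSpace ℝ EM]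
  {M : Type*} [TopologicalSpace M] [ChartedSpace EM M]
  {EP : Type*} [NormedAddCommGroup EP] [NormedSpace ℝ EP]
  {P : Type*} [TopologicalSpace P] [ChartedSpace EP P] [MulAction Gᵐᵒᵖ P]

/-- The derivative `v ↦ v g` of right translation by `g`, from `T_p P` to `T_{pg} P`. -/
def rightMap (EP : Type*) [NormedAddCommGroup EP] [NormedSpace ℝ EP]
    {P : Type*} [TopologicalSpace P] [ChartedSpace EP P] [MulAction Gᵐᵒᵖ P] (p : P) (g : G) :
    TangentSpace 𝓘(ℝ, EP) p →L[ℝ] TangentSpace 𝓘(ℝ, EP) (p <• g) :=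
  mfderiv 𝓘(ℝ, EP) 𝓘(ℝ, EP) (fun q : P => q <• g) p

/-- The value at `p` of the fundamental vector field of `Y ∈ L(G)`: the derivative at `t = 0` of
`p exp (t Y)`, which is the image of `Y` under the derivative at `1` of `g ↦ p g`. -/
def fundamental (EP : Type*) [NormedAddCommGroup EP] [NormedSpace ℝ EP]
    {P : Type*} [TopologicalSpace P] [ChartedSpace EP P] [MulAction Gᵐᵒᵖ P] (p : P)
    (Y : GroupLieAlgebra 𝓘(ℝ, EG) G) : TangentSpace 𝓘(ℝ, EP) p :=
  mfderiv 𝓘(ℝ, EG) 𝓘(ℝ, EP) (fun g : G => p <• g) 1 Y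

/-- `A` is a (smooth) connection form on the principal bundle `P`. -/
structure IsConnectionForm [IsManifold 𝓘(ℝ, EP) ∞ P]
    (A : ∀ p : P, TangentSpace 𝓘(ℝ, EP) p →L[ℝ] GroupLieAlgebra 𝓘(ℝ, EG) G) : Prop where
  smooth : ContMDiff 𝓘(ℝ, EP) (𝓘(ℝ, EP).prod 𝓘(ℝ, EP →L[ℝ] EG)) ∞
    (fun p => Bundle.TotalSpace.mk' (EP →L[ℝ] EG)
      (E := fun p : P => TangentSpace 𝓘(ℝ, EP) p →L[ℝ] Bundle.Trivial P EG p) p (A p))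
  equivariant : ∀ (p : P) (g : G) (v : TangentSpace 𝓘(ℝ, EP) p),
    A (p <• g) (rightMap EP p g v) = Ad g⁻¹ (A p v)
  vertical : ∀ (p : P) (Y : GroupLieAlgebra 𝓘(ℝ, EG) G), A p (fundamental EP p Y) = Y

/-- `B` is a (smooth) `α`-equivariant `L(H)`-valued 2-form on `P` that vanishes on vertical
vectors. -/
structure IsEquivariantTwoForm [IsManifold 𝓘(ℝ, EP) ∞ P] (EM : Type*) [NormedAddCommGroup EM]
    [NormedSpace ℝ EM] {M : Type*} [TopologicalSpace M] [ChartedSpace EM M]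
    (π : P → M) (α : G →* MulAut H)
    (B : ∀ p : P, TangentSpace 𝓘(ℝ, EP) p →L[ℝ] TangentSpace 𝓘(ℝ, EP) p →L[ℝ]
      GroupLieAlgebra 𝓘(ℝ, EH) H) : Prop where
  smooth : ContMDiff 𝓘(ℝ, EP) (𝓘(ℝ, EP).prod 𝓘(ℝ, EP →L[ℝ] EP →L[ℝ] EH)) ∞
    (fun p => Bundle.TotalSpace.mk' (EP →L[ℝ] EP →L[ℝ] EH)
      (E := fun p : P => TangentSpace 𝓘(ℝ, EP) p →L[ℝ] TangentSpace 𝓘(ℝ, EP) p →L[ℝ]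
        Bundle.Trivial P EH p) p (B p))
  alternating : ∀ (p : P) (v : TangentSpace 𝓘(ℝ, EP) p), B p v v = 0
  equivariant : ∀ (p : P) (g : G) (v w : TangentSpace 𝓘(ℝ, EP) p),
    B (p <• g) (rightMap EP p g v) (rightMap EP p g w)
      = lieMap (α g⁻¹).toMonoidHom (B p v w)
  vertical : ∀ (p : P) (v w : TangentSpace 𝓘(ℝ, EP) p),
    mfderiv 𝓘(ℝ, EP) 𝓘(ℝ, EM) π p v = 0 → B p v w = 0

/-- The velocity at `t` of a path `γ : [t₀, t₁] → X` (one-sided at the end points). -/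
def velocity (E : Type*) [NormedAddCommGroup E] [NormedSpace ℝ E]
    {X : Type*} [TopologicalSpace X] [ChartedSpace E X] (t₀ t₁ : ℝ) (γ : ℝ → X) (t : ℝ) :
    TangentSpace 𝓘(ℝ, E) (γ t) :=
  mfderivWithin 𝓘(ℝ, ℝ) 𝓘(ℝ, E) γ (Icc t₀ t₁) t (1 : ℝ)

/-- The maps `Γ : [s₀, s₁] × [t₀, t₁] → X` whose two partial derivatives are linearly dependent
at every point. -/
def IsThin (E : Type*) [NormedAddCommGroup E] [NormedSpace ℝ E]
    {X : Type*} [TopologicalSpace X] [ChartedSpace E X] (s₀ s₁ t₀ t₁ : ℝ) (Γ : ℝ × ℝ → X) : Prop :=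
  ∀ u ∈ Icc s₀ s₁, ∀ v ∈ Icc t₀ t₁,
    ¬ LinearIndependent ℝ (M := TangentSpace 𝓘(ℝ, E) (Γ (u, v)))
      ![velocity E s₀ s₁ (fun s => Γ (s, v)) u, velocity E t₀ t₁ (fun t => Γ (u, t)) v]

/-- `γ : [t₀, t₁] → P` is a `C^∞` path that is horizontal for the connection form `A`. -/
def IsHorizontalPath
    (A : ∀ p : P, TangentSpace 𝓘(ℝ, EP) p →L[ℝ] GroupLieAlgebra 𝓘(ℝ, EG) G)
    (t₀ t₁ : ℝ) (γ : ℝ → P) : Prop :=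
  ContMDiffOn 𝓘(ℝ, ℝ) 𝓘(ℝ, EP) ∞ γ (Icc t₀ t₁) ∧
    ∀ t ∈ Icc t₀ t₁, A (γ t) (velocity EP t₀ t₁ γ t) = 0

/-- `γ` is an `A`-horizontal lift to `P` of the path `c : [t₀, t₁] → M`. -/
def IsHorizontalLift {M : Type*} (π : P → M)
    (A : ∀ p : P, TangentSpace 𝓘(ℝ, EP) p →L[ℝ] GroupLieAlgebra 𝓘(ℝ, EG) G)
    (t₀ t₁ : ℝ) (c : ℝ → M) (γ : ℝ → P) : Prop :=
  IsHorizontalPath A t₀ t₁ γ ∧ ∀ t ∈ Icc t₀ t₁, π (γ t) = c t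

/-- The form `ω_(A,B)` evaluated on a vector field `v` along a path `γ : [t₀, t₁] → P`:
`A (v t₀) + τ (∫ B (γ' t, v t) dt)`, with `τ` also denoting the derivative `L(H) → L(G)`. -/
def omega (A : ∀ p : P, TangentSpace 𝓘(ℝ, EP) p →L[ℝ] GroupLieAlgebra 𝓘(ℝ, EG) G)
    (B : ∀ p : P, TangentSpace 𝓘(ℝ, EP) p →L[ℝ] TangentSpace 𝓘(ℝ, EP) p →L[ℝ]
      GroupLieAlgebra 𝓘(ℝ, EH) H)
    (τ : H →* G) (t₀ t₁ : ℝ) (γ : ℝ → P) (v : ∀ t, TangentSpace 𝓘(ℝ, EP) (γ t)) :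
    GroupLieAlgebra 𝓘(ℝ, EG) G :=
  A (γ t₀) (v t₀) +
    lieMap τ (∫ t in t₀..t₁, (B (γ t) (velocity EP t₀ t₁ γ t) (v t) : EH) : EH)

/-- `Γt : [s₀, s₁] × [t₀, t₁] → P`, viewed as the path `u ↦ Γt (u, ·)` in the space of
`Abar`-horizontal paths on `P`, is an `ω_(A,B)`-horizontal lift of the path of paths
`u ↦ Γ (u, ·)` on `M`. -/
structure IsOmegaHorizontalLift {M : Type*} (π : P → M)
    (Abar A : ∀ p : P, TangentSpace 𝓘(ℝ, EP) p →L[ℝ] GroupLieAlgebra 𝓘(ℝ, EG) G)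
    (B : ∀ p : P, TangentSpace 𝓘(ℝ, EP) p →L[ℝ] TangentSpace 𝓘(ℝ, EP) p →L[ℝ]
      GroupLieAlgebra 𝓘(ℝ, EH) H)
    (τ : H →* G) (s₀ s₁ t₀ t₁ : ℝ) (Γ : ℝ × ℝ → M) (Γt : ℝ × ℝ → P) : Prop where
  smooth : ContMDiffOn 𝓘(ℝ, ℝ × ℝ) 𝓘(ℝ, EP) ∞ Γt (Icc s₀ s₁ ×ˢ Icc t₀ t₁)
  lift : ∀ u ∈ Icc s₀ s₁,
    IsHorizontalLift π Abar t₀ t₁ (fun v => Γ (u, v)) (fun v => Γt (u, v))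
  horizontal : ∀ u ∈ Icc s₀ s₁,
    omega A B τ t₀ t₁ (fun v => Γt (u, v))
      (fun v => velocity EP s₀ s₁ (fun s => Γt (s, v)) u) = 0

end Bundle

end PathConn

end

open PathConn

/-!
Since `Γ` has rank at most one, every bundle pulled back along `Γ` carries only flat connections:
the curvature is a horizontal 2-form, and a horizontal alternating form vanishes on two vectors with
linearly dependent projections. By the Frobenius theorem `Γ` therefore has, near each point, lifts
to `P` that are `Abar`-horizontal in all directions. Two such lifts differ by a constant of `G`, so
they glue to a lift `F` of the whole rectangle with prescribed value at a corner.

The slices `F (u, ·)` are the horizontal lifts of the paths `Γ (u, ·)`, and the edges of the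
rectangle on which `Γ` is constant are mapped to horizontal lifts of constant paths, so `F` is
constant on them. The integral of `B` in `ω_(A,B)` vanishes for every lift of `Γ`, again by
horizontality of `B`; being `ω_(A,B)`-horizontal thus says only that the initial points move
`A`-horizontally, over a path which they already project to, and this gives uniqueness.
-/

namespace PathConn

open Metric Filter Topology
open scoped NNReal

section Frobenius

variable {E' E : Type*} [NormedAddCommGroup E'] [NormedSpace ℝ E']
  [NormedAddCommGroup E] [NormedSpace ℝ E]

theorem gronwallBound_zero_left (k e x : ℝ) :
    gronwallBound 0 k e x = e * gronwallBound 0 k 1 x := by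
  by_cases hk : k = 0
  · subst hk
    simp only [gronwallBound_K0]
    ring
  · simp only [gronwallBound_of_K_ne_0 hk]
    ring

theorem exists_hasDerivWithinAt_mem_closedBall [CompleteSpace E] {f : ℝ → E → E} {tmin tmax : ℝ}
    {t₀ : Icc tmin tmax} {x₀ : E} {a L K : ℝ≥0} (hf : IsPicardLindelof f t₀ x₀ a 0 L K) :
    ∃ α : ℝ → E, α t₀ = x₀ ∧ (∀ t, α t ∈ closedBall x₀ a) ∧
      ∀ t ∈ Icc tmin tmax, HasDerivWithinAt α (f t (α t)) (Icc tmin tmax) t := by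
  have hx₀ : x₀ ∈ closedBall x₀ ((0 : ℝ≥0) : ℝ) := mem_closedBall_self le_rfl
  obtain ⟨α, hα⟩ := ODE.FunSpace.exists_isFixedPt_next hf hx₀
  have hball (t : ℝ) : α.compProj t ∈ closedBall x₀ a := α.compProj_mem_closedBall hf.mul_max_le
  have hpicard : ∀ t ∈ Icc tmin tmax, α.compProj t = ODE.picard f t₀ x₀ α.compProj t := by
    intro t ht
    nth_rw 1 [← hα]
    rw [ODE.FunSpace.compProj_of_mem ht, ODE.FunSpace.next_apply]
  refine ⟨α.compProj, by rw [ODE.FunSpace.compProj_val, ← hα, ODE.FunSpace.next_apply₀], hball,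
    fun t ht => ?_⟩
  exact (ODE.hasDerivWithinAt_picard_Icc t₀.2 hf.continuousOn_uncurry
    α.continuous_compProj.continuousOn (fun t _ => hball t) x₀ ht).congr_of_mem hpicard ht

theorem norm_sub_sub_le_of_lipschitzOnWith {D : Set E'} (hD : Convex ℝ D) {f : E' → E}
    {f' : E' → E' →L[ℝ] E} (hf : ∀ z ∈ D, HasFDerivWithinAt f (f' z) D z) {K : ℝ≥0}
    (hK : LipschitzOnWith K f' D) {p q : E'} (hp : p ∈ D) (hq : q ∈ D) :
    ‖f q - f p - f' p (q - p)‖ ≤ K * ‖q - p‖ * ‖q - p‖ := by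
  have hsub : segment ℝ p q ⊆ D := hD.segment_subset hp hq
  refine (convex_segment p q).norm_image_sub_le_of_norm_hasFDerivWithin_le' (f' := f')
    (fun z hz => (hf z (hsub hz)).mono hsub) (fun z hz => ?_) (left_mem_segment ℝ p q)
    (right_mem_segment ℝ p q)
  calc ‖f' z - f' p‖ ≤ K * ‖z - p‖ := hK.norm_sub_le (hsub hz) hp
    _ ≤ K * ‖q - p‖ := by
      gcongr
      simpa [dist_eq_norm, norm_sub_rev] using segment_subset_closedBall_left p q hz

theorem hasFDerivWithinAt_of_norm_sub_sub_le {S : Set E'} {x : E'} (hx : x ∈ S) {g : E' → E}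
    {g' : E' →L[ℝ] E} {c : ℝ}
    (h : ∀ᶠ x' in 𝓝[S] x, ‖g x' - g x - g' (x' - x)‖ ≤ c * ‖x' - x‖ ^ 2) :
    HasFDerivWithinAt g g' S x := by
  have hO : (fun x' => g x' - g x - g' (x' - x)) =O[𝓝[S] x] fun x' => ‖x' - x‖ ^ 2 :=
    .of_bound c (by simpa only [norm_pow, norm_norm] using h)
  have hremainder : HasFDerivWithinAt (fun x' => g x' - g x - g' (x' - x)) (0 : E' →L[ℝ] E) S x :=
    hO.hasFDerivWithinAt hx (by norm_num)
  have hsum := (hremainder.add (g'.hasFDerivWithinAt (s := S) (x := x))).add_const (g x - g' x)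
  rw [zero_add] at hsum
  refine hsum.congr' (fun x' _ => ?_) hx
  simp only [Pi.add_apply, map_sub]
  abel

/-- An integrable total differential equation `Dg = η (x, g x)` on the box `T × B(y₀, ε)`, with
explicit bounds: `η` has derivative `η'`, both are `K`-Lipschitz, `‖η‖ ≤ C`, and `T` is so small
that solutions starting at `y₀` stay within `ε / 2` of `y₀`. The field `symm` is the Frobenius
condition. -/
structure IsIntegrableBox (T : Set E') (x₀ : E') (y₀ : E) (ε : ℝ) (ρ C K : ℝ≥0)
    (η : E' × E → E' →L[ℝ] E) (η' : E' × E → E' × E →L[ℝ] E' →L[ℝ] E) : Prop where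
  convex : Convex ℝ T
  center_mem : x₀ ∈ T
  radius_pos : 0 < ε
  norm_sub_le : ∀ x ∈ T, ‖x - x₀‖ ≤ ρ
  mul_le : C * ρ ≤ ε / 2
  hasFDerivWithinAt : ∀ z ∈ T ×ˢ ball y₀ ε, HasFDerivWithinAt η (η' z) (T ×ˢ ball y₀ ε) z
  lipschitzOnWith : LipschitzOnWith K η (T ×ˢ ball y₀ ε)
  lipschitzOnWith_deriv : LipschitzOnWith K η' (T ×ˢ ball y₀ ε)
  norm_le : ∀ z ∈ T ×ˢ ball y₀ ε, ‖η z‖ ≤ C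
  symm : ∀ z ∈ T ×ˢ ball y₀ ε, ∀ ξ ξ', η' z (ξ, η z ξ) ξ' = η' z (ξ', η z ξ') ξ

/-- `z` solves the total differential equation `Dg = η (x, g x)`, `g x₀ = y₀`, along the segment
from `x₀` to `x₀ + ξ`, staying in the closed ball of radius `r` around `y₀`. -/
structure IsRaySolution (η : E' × E → E' →L[ℝ] E) (x₀ : E') (y₀ : E) (r : ℝ) (ξ : E')
    (z : ℝ → E) : Prop where
  init : z 0 = y₀
  mem_closedBall : ∀ t, z t ∈ closedBall y₀ r
  hasDerivWithinAt : ∀ t ∈ Icc (0 : ℝ) 1,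
    HasDerivWithinAt z (η (x₀ + t • ξ, z t) ξ) (Icc 0 1) t

theorem IsRaySolution.eq_of_zero {η : E' × E → E' →L[ℝ] E} {x₀ : E'} {y₀ : E} {r : ℝ} {z : ℝ → E}
    (hz : IsRaySolution η x₀ y₀ r 0 z) : z 1 = y₀ := by
  have hderiv : ∀ t ∈ Icc (0 : ℝ) 1, HasDerivWithinAt z 0 (Icc 0 1) t := by
    simpa only [map_zero] using hz.hasDerivWithinAt
  rw [← hz.init]
  exact constant_of_has_deriv_right_zero (fun t ht => (hderiv t ht).continuousWithinAt)
    (fun t ht => (hderiv t (Ico_subset_Icc_self ht)).mono_of_mem_nhdsWithin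
      (Icc_mem_nhdsGE_of_mem ht)) 1 (right_mem_Icc.2 zero_le_one)

namespace IsIntegrableBox

variable {T : Set E'} {x₀ : E'} {y₀ : E} {ε : ℝ} {ρ C K : ℝ≥0} {η : E' × E → E' →L[ℝ] E}
  {η' : E' × E → E' × E →L[ℝ] E' →L[ℝ] E} {x x' : E'} {z z' : ℝ → E} {t : ℝ}

theorem closedBall_subset (h : IsIntegrableBox T x₀ y₀ ε ρ C K η η') :
    closedBall y₀ (ε / 2) ⊆ ball y₀ ε :=
  closedBall_subset_ball (half_lt_self h.radius_pos)

theorem ray_mem (h : IsIntegrableBox T x₀ y₀ ε ρ C K η η') (hx : x ∈ T) (ht : t ∈ Icc (0 : ℝ) 1) :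
    x₀ + t • (x - x₀) ∈ T :=
  h.convex.add_smul_sub_mem h.center_mem hx ht

theorem lipschitzOnWith_ray (h : IsIntegrableBox T x₀ y₀ ε ρ C K η η') (hx : x ∈ T)
    (ht : t ∈ Icc (0 : ℝ) 1) :
    LipschitzOnWith (K * ρ) (fun y => η (x₀ + t • (x - x₀), y) (x - x₀)) (ball y₀ ε) := by
  refine LipschitzOnWith.of_dist_le_mul fun y hy y' hy' => ?_
  have hη := h.lipschitzOnWith.norm_sub_le (x := (x₀ + t • (x - x₀), y))
    (y := (x₀ + t • (x - x₀), y')) ⟨h.ray_mem hx ht, hy⟩ ⟨h.ray_mem hx ht, hy'⟩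
  rw [Prod.mk_sub_mk, sub_self, Prod.norm_mk, norm_zero, max_eq_right (norm_nonneg _)] at hη
  rw [dist_eq_norm, dist_eq_norm, ← sub_apply]
  calc ‖(η (x₀ + t • (x - x₀), y) - η (x₀ + t • (x - x₀), y')) (x - x₀)‖
      ≤ (K * ‖y - y'‖) * ρ := ContinuousLinearMap.le_of_opNorm_le_of_le _ hη (h.norm_sub_le x hx)
    _ = (K * ρ : ℝ≥0) * ‖y - y'‖ := by push_cast; ring

theorem isPicardLindelof (h : IsIntegrableBox T x₀ y₀ ε ρ C K η η') (hx : x ∈ T) :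
    IsPicardLindelof (fun t y => η (x₀ + t • (x - x₀), y) (x - x₀))
      (⟨0, left_mem_Icc.2 zero_le_one⟩ : Icc (0 : ℝ) 1) y₀ ⟨ε / 2, (half_pos h.radius_pos).le⟩ 0
      (C * ρ) (K * ρ) where
  lipschitzOnWith _ ht := (h.lipschitzOnWith_ray hx ht).mono h.closedBall_subset
  continuousOn y hy := by
    have hη : ContinuousOn (fun t : ℝ => η (x₀ + t • (x - x₀), y)) (Icc 0 1) :=
      h.lipschitzOnWith.continuousOn.comp (f := fun t : ℝ => (x₀ + t • (x - x₀), y)) (by fun_prop)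
        fun t ht => ⟨h.ray_mem hx ht, h.closedBall_subset hy⟩
    exact hη.clm_apply continuousOn_const
  norm_le t ht y hy := by
    push_cast
    exact ContinuousLinearMap.le_of_opNorm_le_of_le _
      (h.norm_le _ ⟨h.ray_mem hx ht, h.closedBall_subset hy⟩) (h.norm_sub_le x hx)
  mul_max_le := by
    change (C : ℝ) * ρ * max (1 - 0) (0 - 0) ≤ ε / 2 - 0
    simpa using h.mul_le

theorem exists_isRaySolution [CompleteSpace E] (h : IsIntegrableBox T x₀ y₀ ε ρ C K η η')
    (hx : x ∈ T) : ∃ z, IsRaySolution η x₀ y₀ (ε / 2) (x - x₀) z := by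
  obtain ⟨z, hinit, hball, hderiv⟩ := exists_hasDerivWithinAt_mem_closedBall (h.isPicardLindelof hx)
  exact ⟨z, hinit, hball, hderiv⟩

theorem graph_mem (h : IsIntegrableBox T x₀ y₀ ε ρ C K η η') (hx : x ∈ T)
    (hz : IsRaySolution η x₀ y₀ (ε / 2) (x - x₀) z) (ht : t ∈ Icc (0 : ℝ) 1) :
    (x₀ + t • (x - x₀), z t) ∈ T ×ˢ ball y₀ ε :=
  ⟨h.ray_mem hx ht, h.closedBall_subset (hz.mem_closedBall t)⟩

theorem norm_smul_apply_le (h : IsIntegrableBox T x₀ y₀ ε ρ C K η η') {p : E' × E}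
    (hp : p ∈ T ×ˢ ball y₀ ε) (ht : t ∈ Icc (0 : ℝ) 1) (δ : E') : ‖t • η p δ‖ ≤ C * ‖δ‖ :=
  calc ‖t • η p δ‖ = t * ‖η p δ‖ := by rw [norm_smul, Real.norm_of_nonneg ht.1]
    _ ≤ 1 * (C * ‖δ‖) := by
      gcongr
      exacts [ht.2, (η p).le_of_opNorm_le (h.norm_le p hp) δ]
    _ = C * ‖δ‖ := one_mul _

/-- The first-order approximation `t ↦ z t + t η(c t) (x' - x)` of the ray solution towards `x'`,
given the ray solution `z` towards `x`; here `c t = (x₀ + t (x - x₀), z t)`. By the Frobenius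
condition `t η(c t) (x' - x)` solves the linearised equation along `z`. -/
def rayVariation (η : E' × E → E' →L[ℝ] E) (x₀ x x' : E') (z : ℝ → E) (t : ℝ) : E :=
  z t + t • η (x₀ + t • (x - x₀), z t) (x' - x)

theorem hasDerivWithinAt_rayVariation (h : IsIntegrableBox T x₀ y₀ ε ρ C K η η') (hx : x ∈ T)
    (hz : IsRaySolution η x₀ y₀ (ε / 2) (x - x₀) z) (ht : t ∈ Icc (0 : ℝ) 1) {c : E' × E}
    (hc : c = (x₀ + t • (x - x₀), z t)) :
    HasDerivWithinAt (rayVariation η x₀ x x' z)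
      (η c (x - x₀) + (t • η' c (x - x₀, η c (x - x₀)) (x' - x) + η c (x' - x))) (Icc 0 1) t := by
  subst hc
  have hline : HasDerivWithinAt (fun t : ℝ => x₀ + t • (x - x₀)) (x - x₀) (Icc 0 1) t := by
    simpa using ((hasDerivWithinAt_id t (Icc 0 1)).smul_const (x - x₀)).const_add x₀
  have hη := (h.hasFDerivWithinAt _ (h.graph_mem hx hz ht)).comp_hasDerivWithinAt t
    (hline.prodMk (hz.hasDerivWithinAt t ht)) (fun s hs => h.graph_mem hx hz hs)
  have hηδ := hη.clm_apply (hasDerivWithinAt_const t (Icc 0 1) (x' - x))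
  have hsum := (hz.hasDerivWithinAt t ht).fun_add
    ((hasDerivWithinAt_id t (Icc 0 1)).fun_smul hηδ)
  simp only [id, map_zero, add_zero, one_smul] at hsum
  exact hsum

theorem rayVariation_mem_ball (h : IsIntegrableBox T x₀ y₀ ε ρ C K η η') (hx : x ∈ T)
    (hxx' : C * ‖x' - x‖ < ε / 2) (hz : IsRaySolution η x₀ y₀ (ε / 2) (x - x₀) z)
    (ht : t ∈ Icc (0 : ℝ) 1) : rayVariation η x₀ x x' z t ∈ ball y₀ ε := by
  have hzt : ‖z t - y₀‖ ≤ ε / 2 := mem_closedBall_iff_norm.1 (hz.mem_closedBall t)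
  rw [mem_ball_iff_norm, rayVariation, add_sub_right_comm]
  calc ‖z t - y₀ + t • η (x₀ + t • (x - x₀), z t) (x' - x)‖
      ≤ ε / 2 + C * ‖x' - x‖ :=
        norm_add_le_of_le hzt (h.norm_smul_apply_le (h.graph_mem hx hz ht) ht _)
    _ < ε := by linarith

theorem rayVariation_error_le (h : IsIntegrableBox T x₀ y₀ ε ρ C K η η') (hx : x ∈ T)
    (hx' : x' ∈ T) (hxx' : C * ‖x' - x‖ < ε / 2)
    (hz : IsRaySolution η x₀ y₀ (ε / 2) (x - x₀) z) (ht : t ∈ Icc (0 : ℝ) 1) {c : E' × E}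
    (hc : c = (x₀ + t • (x - x₀), z t)) :
    dist (η c (x - x₀) + (t • η' c (x - x₀, η c (x - x₀)) (x' - x) + η c (x' - x)))
      (η (x₀ + t • (x' - x₀), rayVariation η x₀ x x' z t) (x' - x₀)) ≤
      (K * (1 + C) ^ 2 * ρ + K * (1 + C)) * ‖x' - x‖ ^ 2 := by
  have hcD : c ∈ T ×ˢ ball y₀ ε := hc ▸ h.graph_mem hx hz ht
  set d : E' × E := (t • (x' - x), t • η c (x' - x)) with hd
  have hcd : (x₀ + t • (x' - x₀), rayVariation η x₀ x x' z t) = c + d := by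
    rw [hd, hc, Prod.mk_add_mk, rayVariation]
    congr 1
    module
  have hcdD : c + d ∈ T ×ˢ ball y₀ ε :=
    hcd ▸ ⟨h.ray_mem hx' ht, h.rayVariation_mem_ball hx hxx' hz ht⟩
  have hd_le : ‖d‖ ≤ (1 + C) * ‖x' - x‖ := by
    rw [Prod.norm_def, sup_le_iff, norm_smul, Real.norm_of_nonneg ht.1]
    have hCδ := mul_nonneg C.coe_nonneg (norm_nonneg (x' - x))
    exact ⟨by nlinarith [ht.2, norm_nonneg (x' - x)],
      (h.norm_smul_apply_le hcD ht _).trans (by linarith [norm_nonneg (x' - x)])⟩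
  have hfrobenius : t • η' c (x - x₀, η c (x - x₀)) (x' - x) = η' c d (x - x₀) := by
    rw [h.symm c hcD, ← smul_apply, ← map_smul, Prod.smul_mk]
  have htaylor := norm_sub_sub_le_of_lipschitzOnWith (h.convex.prod (convex_ball y₀ ε))
    h.hasFDerivWithinAt h.lipschitzOnWith_deriv hcD hcdD
  have hlip := h.lipschitzOnWith.norm_sub_le hcdD hcD
  rw [add_sub_cancel_left] at htaylor hlip
  have hsplit : η c (x - x₀) + (η' c d (x - x₀) + η c (x' - x)) - η (c + d) (x' - x₀) =
      -((η (c + d) - η c - η' c d) (x - x₀)) - (η (c + d) - η c) (x' - x) := by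
    rw [← sub_add_sub_cancel' x x₀ x', map_add]
    simp only [sub_apply]
    abel
  rw [dist_eq_norm, hcd, hfrobenius, hsplit]
  calc _ ≤ ‖(η (c + d) - η c - η' c d) (x - x₀)‖ + ‖(η (c + d) - η c) (x' - x)‖ :=
        (_root_.norm_sub_le _ _).trans_eq (by rw [norm_neg])
    _ ≤ (K * ‖d‖ * ‖d‖) * ρ + (K * ‖d‖) * ‖x' - x‖ :=
        add_le_add (ContinuousLinearMap.le_of_opNorm_le_of_le _ htaylor (h.norm_sub_le x hx))
          (ContinuousLinearMap.le_of_opNorm_le _ hlip _)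
    _ ≤ (K * ((1 + C) * ‖x' - x‖) * ((1 + C) * ‖x' - x‖)) * ρ +
          (K * ((1 + C) * ‖x' - x‖)) * ‖x' - x‖ := by gcongr
    _ = _ := by ring

theorem norm_isRaySolution_sub_le (h : IsIntegrableBox T x₀ y₀ ε ρ C K η η') (hx : x ∈ T)
    (hx' : x' ∈ T) (hxx' : C * ‖x' - x‖ < ε / 2) (hz : IsRaySolution η x₀ y₀ (ε / 2) (x - x₀) z)
    (hz' : IsRaySolution η x₀ y₀ (ε / 2) (x' - x₀) z') :
    ‖z' 1 - z 1 - η (x, z 1) (x' - x)‖ ≤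
      (K * (1 + C) ^ 2 * ρ + K * (1 + C)) * gronwallBound 0 (K * ρ) 1 1 * ‖x' - x‖ ^ 2 := by
  have hIci : ∀ t ∈ Ico (0 : ℝ) 1, Icc (0 : ℝ) 1 ∈ 𝓝[≥] t := fun t ht =>
    Icc_mem_nhdsGE_of_mem ht
  have hw := fun t (ht : t ∈ Icc (0 : ℝ) 1) =>
    h.hasDerivWithinAt_rayVariation (x' := x') hx hz ht rfl
  have hdist := dist_le_of_approx_trajectories_ODE_of_mem
    (v := fun t y => η (x₀ + t • (x' - x₀), y) (x' - x₀)) (s := fun _ => ball y₀ ε)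
    (g := rayVariation η x₀ x x' z) (εf := 0) (δ := 0)
    (fun t ht => h.lipschitzOnWith_ray hx' (Ico_subset_Icc_self ht))
    (fun t ht => (hz'.hasDerivWithinAt t ht).continuousWithinAt)
    (fun t ht => (hz'.hasDerivWithinAt t (Ico_subset_Icc_self ht)).mono_of_mem_nhdsWithin
      (hIci t ht))
    (fun t _ => (dist_self _).le)
    (fun t _ => h.closedBall_subset (hz'.mem_closedBall t))
    (fun t ht => (hw t ht).continuousWithinAt)
    (fun t ht => (hw t (Ico_subset_Icc_self ht)).mono_of_mem_nhdsWithin (hIci t ht))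
    (fun t ht => h.rayVariation_error_le hx hx' hxx' hz (Ico_subset_Icc_self ht) rfl)
    (fun t ht => h.rayVariation_mem_ball hx hxx' hz (Ico_subset_Icc_self ht))
    (by simp [rayVariation, hz.init, hz'.init]) 1 (right_mem_Icc.2 zero_le_one)
  rw [gronwallBound_zero_left, dist_eq_norm, rayVariation, one_smul, one_smul, add_sub_cancel,
    ← sub_sub] at hdist
  refine hdist.trans_eq ?_
  push_cast
  rw [zero_add, sub_zero, mul_right_comm]

theorem exists_hasFDerivWithinAt [CompleteSpace E] (h : IsIntegrableBox T x₀ y₀ ε ρ C K η η') :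
    ∃ g : E' → E, g x₀ = y₀ ∧
      ∀ x ∈ T, g x ∈ ball y₀ ε ∧ HasFDerivWithinAt g (η (x, g x)) T x := by
  choose! z hz using fun x hx => h.exists_isRaySolution (x := x) hx
  refine ⟨fun x => z x 1, ?_, fun x hx =>
    ⟨h.closedBall_subset ((hz x hx).mem_closedBall 1), ?_⟩⟩
  · exact (sub_self x₀ ▸ hz x₀ h.center_mem).eq_of_zero
  · have hnear : ∀ᶠ x' in 𝓝[T] x, C * ‖x' - x‖ < ε / 2 := by
      have hlim : Tendsto (fun x' => C * ‖x' - x‖) (𝓝[T] x) (𝓝 (C * ‖x - x‖)) :=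
        Continuous.continuousWithinAt (by fun_prop)
      exact hlim.eventually_lt_const (by simpa using half_pos h.radius_pos)
    refine hasFDerivWithinAt_of_norm_sub_sub_le hx
      (c := (K * (1 + C) ^ 2 * ρ + K * (1 + C)) * gronwallBound 0 (K * ρ) 1 1) ?_
    filter_upwards [hnear, self_mem_nhdsWithin] with x' hxx' hx'
    exact h.norm_isRaySolution_sub_le hx hx' hxx' (hz x hx) (hz x' hx')

end IsIntegrableBox

theorem exists_isIntegrableBox {S : Set E'} (hS : Convex ℝ S) (hSi : (interior S).Nonempty)
    {x₀ : E'} (hx₀ : x₀ ∈ S) {y₀ : E} {η : E' × E → E' →L[ℝ] E}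
    (hη : ∀ᶠ z in 𝓝[S ×ˢ univ] (x₀, y₀), ContDiffWithinAt ℝ ∞ η (S ×ˢ univ) z)
    (hsymm : ∀ᶠ z in 𝓝[S ×ˢ univ] (x₀, y₀), ∀ ξ ξ',
      fderivWithin ℝ η (S ×ˢ univ) z (ξ, η z ξ) ξ' =
        fderivWithin ℝ η (S ×ˢ univ) z (ξ', η z ξ') ξ) :
    ∃ ρ > 0, ∃ ε, (∀ z ∈ (S ∩ ball x₀ ρ) ×ˢ ball y₀ ε, ContDiffWithinAt ℝ ∞ η (S ×ˢ univ) z) ∧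
      ∃ ρ' C K : ℝ≥0, IsIntegrableBox (S ∩ ball x₀ ρ) x₀ y₀ ε ρ' C K η
        (fderivWithin ℝ η (S ×ˢ univ)) := by
  have hz₀ : (x₀, y₀) ∈ S ×ˢ (univ : Set E) := ⟨hx₀, mem_univ y₀⟩
  have hconv : Convex ℝ (S ×ˢ (univ : Set E)) := hS.prod convex_univ
  have hη₀ : ContDiffWithinAt ℝ ∞ η (S ×ˢ univ) (x₀, y₀) := hη.self_of_nhdsWithin hz₀
  have hη'₀ : ContDiffWithinAt ℝ ∞ (fderivWithin ℝ η (S ×ˢ univ)) (S ×ˢ univ) (x₀, y₀) :=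
    hη₀.fderivWithin_right ((uniqueDiffOn_convex hS hSi).prod uniqueDiffOn_univ)
      (by simp) hz₀
  obtain ⟨K, N, hN, hK⟩ := (hη₀.of_le (mod_cast le_top)).exists_lipschitzOnWith hconv
  obtain ⟨K', N', hN', hK'⟩ := (hη'₀.of_le (mod_cast le_top)).exists_lipschitzOnWith hconv
  set C : ℝ≥0 := ‖η (x₀, y₀)‖₊ + 1
  have hbound : ∀ᶠ z in 𝓝[S ×ˢ univ] (x₀, y₀), ‖η z‖ < C :=
    hη₀.continuousWithinAt.norm.eventually_lt_const (by simp [C])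
  obtain ⟨ε, hε, hball⟩ := Metric.mem_nhdsWithin_iff.1
    ((hη.and hsymm).and (hbound.and (inter_mem hN hN')))
  have hCpos : (0 : ℝ) < C := by positivity
  set ρ : ℝ := min ε (ε / 2 / C)
  have hρ : 0 < ρ := lt_min hε (by positivity)
  have hbox : (S ∩ ball x₀ ρ) ×ˢ ball y₀ ε ⊆ ball (x₀, y₀) ε ∩ S ×ˢ univ := by
    rw [← ball_prod_same]
    exact fun z hz => ⟨⟨ball_subset_ball (min_le_left _ _) hz.1.2, hz.2⟩, hz.1.1, mem_univ _⟩
  have hP := fun z (hz : z ∈ (S ∩ ball x₀ ρ) ×ˢ ball y₀ ε) => hball (hbox hz)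
  refine ⟨ρ, hρ, ε, fun z hz => (hP z hz).1.1, ⟨ρ, hρ.le⟩, C, max K K',
    hS.inter (convex_ball _ _), ⟨hx₀, mem_ball_self hρ⟩, hε,
    fun x hx => (mem_ball_iff_norm.1 hx.2).le, ?_, fun z hz => ?_, ?_, ?_,
    fun z hz => (hP z hz).2.1.le, fun z hz => (hP z hz).1.2⟩
  · calc C * ρ ≤ C * (ε / 2 / C) := by gcongr; exact min_le_right _ _
      _ = ε / 2 := by field_simp
  · exact ((hP z hz).1.1.differentiableWithinAt (by simp)).hasFDerivWithinAt.mono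
      (hbox.trans inter_subset_right)
  · exact (hK.mono fun z hz => (hP z hz).2.2.1).weaken (le_max_left _ _)
  · exact (hK'.mono fun z hz => (hP z hz).2.2.2).weaken (le_max_right _ _)

theorem contDiffOn_of_hasFDerivWithinAt_graph {T : Set E'} {D : Set (E' × E)}
    {η : E' × E → E' →L[ℝ] E} (hη : ContDiffOn ℝ ∞ η D) {g : E' → E}
    (hD : ∀ x ∈ T, (x, g x) ∈ D) (hT : UniqueDiffOn ℝ T)
    (hg : ∀ x ∈ T, HasFDerivWithinAt g (η (x, g x)) T x) : ContDiffOn ℝ ∞ g T := by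
  rw [contDiffOn_infty]
  intro n
  induction n with
  | zero => exact contDiffOn_zero.2 fun x hx => (hg x hx).continuousWithinAt
  | succ n ih =>
    rw [Nat.cast_add_one, contDiffOn_succ_iff_hasFDerivWithinAt_of_uniqueDiffOn hT]
    exact ⟨by simp, fun x => η (x, g x),
      (hη.of_le (mod_cast le_top)).comp (contDiffOn_id.prodMk ih) hD, hg⟩

theorem exists_hasFDerivWithinAt_of_integrable [CompleteSpace E] {S : Set E'} (hS : Convex ℝ S)
    (hSi : (interior S).Nonempty) {x₀ : E'} (hx₀ : x₀ ∈ S) {y₀ : E} {η : E' × E → E' →L[ℝ] E}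
    (hη : ∀ᶠ z in 𝓝[S ×ˢ univ] (x₀, y₀), ContDiffWithinAt ℝ ∞ η (S ×ˢ univ) z)
    (hsymm : ∀ᶠ z in 𝓝[S ×ˢ univ] (x₀, y₀), ∀ ξ ξ',
      fderivWithin ℝ η (S ×ˢ univ) z (ξ, η z ξ) ξ' =
        fderivWithin ℝ η (S ×ˢ univ) z (ξ', η z ξ') ξ) :
    ∃ g : E' → E, g x₀ = y₀ ∧ ∀ᶠ x in 𝓝[S] x₀,
      HasFDerivWithinAt g (η (x, g x)) S x ∧ ContDiffWithinAt ℝ ∞ g S x := by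
  obtain ⟨ρ, hρ, ε, hηbox, _, _, _, hbox⟩ := exists_isIntegrableBox hS hSi hx₀ hη hsymm
  obtain ⟨g, hg₀, hg⟩ := hbox.exists_hasFDerivWithinAt
  have hnhds : ∀ x ∈ S ∩ ball x₀ ρ, S ∩ ball x₀ ρ ∈ 𝓝[S] x := fun x hx =>
    inter_mem_nhdsWithin S (isOpen_ball.mem_nhds hx.2)
  have hsmooth : ContDiffOn ℝ ∞ g (S ∩ ball x₀ ρ) :=
    contDiffOn_of_hasFDerivWithinAt_graph (D := (S ∩ ball x₀ ρ) ×ˢ ball y₀ ε)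
      (fun z hz => (hηbox z hz).mono (prod_mono inter_subset_left (subset_univ _)))
      (fun x hx => ⟨hx, (hg x hx).1⟩)
      ((uniqueDiffOn_convex hS hSi).inter isOpen_ball) (fun x hx => (hg x hx).2)
  refine ⟨g, hg₀, mem_of_superset (hnhds x₀ ⟨hx₀, mem_ball_self hρ⟩) fun x hx => ⟨?_, ?_⟩⟩
  · exact (hg x hx).2.mono_of_mem_nhdsWithin (hnhds x hx)
  · exact (hsmooth x hx).mono_of_mem_nhdsWithin (hnhds x hx)

end Frobenius

section Pfaff

variable {E' E F : Type*} [NormedAddCommGroup E'] [NormedSpace ℝ E']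
  [NormedAddCommGroup E] [NormedSpace ℝ E] [NormedAddCommGroup F] [NormedSpace ℝ F]

/-- The restriction of a form on `E' × E` to the vertical directions. -/
def fibrePart (θ : E' × E → E' × E →L[ℝ] F) (z : E' × E) : E →L[ℝ] F :=
  θ z ∘L .inr ℝ E' E

/-- The linear map `E' → E` whose graph is the kernel of `θ z`, when `fibrePart θ z` is
invertible. -/
noncomputable def kernelSlope (θ : E' × E → E' × E →L[ℝ] F) (z : E' × E) : E' →L[ℝ] E :=
  -((fibrePart θ z).inverse ∘L θ z ∘L .inl ℝ E' E)

variable {D : Set (E' × E)} {θ : E' × E → E' × E →L[ℝ] F} {z : E' × E}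

theorem fibrePart_apply_kernelSlope (h : (fibrePart θ z).IsInvertible) (ξ : E') :
    fibrePart θ z (kernelSlope θ z ξ) = -θ z (ξ, 0) := by
  obtain ⟨e, he⟩ := h
  simp [kernelSlope, ← he]

theorem apply_kernelSlope (h : (fibrePart θ z).IsInvertible) (ξ : E') :
    θ z (ξ, kernelSlope θ z ξ) = 0 := by
  have hsplit : (ξ, kernelSlope θ z ξ) = (ξ, 0) + (0, kernelSlope θ z ξ) := by simp
  rw [hsplit, map_add, ← neg_eq_iff_add_eq_zero, ← fibrePart_apply_kernelSlope h]
  rfl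

theorem contDiffWithinAt_fibrePart (hθ : ContDiffWithinAt ℝ ∞ θ D z) :
    ContDiffWithinAt ℝ ∞ (fibrePart θ) D z :=
  hθ.clm_comp contDiffWithinAt_const

theorem eventually_isInvertible_fibrePart [CompleteSpace E] (hz : (fibrePart θ z).IsInvertible)
    (hθ : ContDiffWithinAt ℝ ∞ θ D z) : ∀ᶠ z' in 𝓝[D] z, (fibrePart θ z').IsInvertible :=
  (contDiffWithinAt_fibrePart hθ).continuousWithinAt (ContinuousLinearEquiv.isOpen.mem_nhds hz)

theorem contDiffWithinAt_kernelSlope [CompleteSpace E] (hz : (fibrePart θ z).IsInvertible)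
    (hθ : ContDiffWithinAt ℝ ∞ θ D z) : ContDiffWithinAt ℝ ∞ (kernelSlope θ) D z :=
  ((hz.contDiffAt_map_inverse.comp_contDiffWithinAt z (contDiffWithinAt_fibrePart hθ)).clm_comp
    (hθ.clm_comp contDiffWithinAt_const)).neg

theorem fibrePart_fderivWithin_kernelSlope [CompleteSpace E] (hD : UniqueDiffWithinAt ℝ D z)
    (hz : (fibrePart θ z).IsInvertible) (hθ : ContDiffWithinAt ℝ ∞ θ D z)
    (w : E' × E) (ξ : E') :
    fibrePart θ z (fderivWithin ℝ (kernelSlope θ) D z w ξ) =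
      -fderivWithin ℝ θ D z w (ξ, kernelSlope θ z ξ) := by
  have hslope := ((contDiffWithinAt_kernelSlope hz hθ).differentiableWithinAt
    (by simp)).hasFDerivWithinAt.clm_apply (hasFDerivWithinAt_const ξ z D)
  have hsum := (hθ.differentiableWithinAt (by simp)).hasFDerivWithinAt.clm_apply
    ((hasFDerivWithinAt_const ξ z D).prodMk hslope)
  have hzero : HasFDerivWithinAt (fun z' => θ z' (ξ, kernelSlope θ z' ξ)) 0 D z :=
    (hasFDerivWithinAt_const (𝕜 := ℝ) (0 : F) z D).congr_of_eventuallyEq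
      ((eventually_isInvertible_fibrePart hz hθ).mono fun z' hz' => apply_kernelSlope hz' ξ)
      (apply_kernelSlope hz ξ)
  have heq := DFunLike.congr_fun (hD.eq hsum hzero) w
  rw [eq_neg_iff_add_eq_zero]
  simpa [fibrePart] using heq

theorem fderivWithin_kernelSlope_comm [CompleteSpace E] (hD : UniqueDiffWithinAt ℝ D z)
    (hz : (fibrePart θ z).IsInvertible) (hθ : ContDiffWithinAt ℝ ∞ θ D z)
    (hsymm : ∀ w w', θ z w = 0 → θ z w' = 0 →
      fderivWithin ℝ θ D z w w' = fderivWithin ℝ θ D z w' w) (ξ ξ' : E') :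
    fderivWithin ℝ (kernelSlope θ) D z (ξ, kernelSlope θ z ξ) ξ' =
      fderivWithin ℝ (kernelSlope θ) D z (ξ', kernelSlope θ z ξ') ξ := by
  refine hz.injective ?_
  rw [fibrePart_fderivWithin_kernelSlope hD hz hθ,
    fibrePart_fderivWithin_kernelSlope hD hz hθ,
    hsymm _ _ (apply_kernelSlope hz ξ) (apply_kernelSlope hz ξ')]

theorem exists_graph_tangent_ker [CompleteSpace E] {S : Set E'} (hS : Convex ℝ S)
    (hSi : (interior S).Nonempty) {x₀ : E'} (hx₀ : x₀ ∈ S) {y₀ : E}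
    (hθ : ∀ᶠ z in 𝓝[S ×ˢ univ] (x₀, y₀), ContDiffWithinAt ℝ ∞ θ (S ×ˢ univ) z)
    (hinv : (fibrePart θ (x₀, y₀)).IsInvertible)
    (hsymm : ∀ᶠ z in 𝓝[S ×ˢ univ] (x₀, y₀), ∀ w w', θ z w = 0 → θ z w' = 0 →
      fderivWithin ℝ θ (S ×ˢ univ) z w w' = fderivWithin ℝ θ (S ×ˢ univ) z w' w) :
    ∃ g : E' → E, g x₀ = y₀ ∧ ∀ᶠ x in 𝓝[S] x₀, ContDiffWithinAt ℝ ∞ g S x ∧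
      ∃ g' : E' →L[ℝ] E, HasFDerivWithinAt g g' S x ∧ ∀ ξ, θ (x, g x) (ξ, g' ξ) = 0 := by
  have hz₀ : (x₀, y₀) ∈ S ×ˢ (univ : Set E) := ⟨hx₀, mem_univ y₀⟩
  have hD : UniqueDiffOn ℝ (S ×ˢ (univ : Set E)) :=
    (uniqueDiffOn_convex hS hSi).prod uniqueDiffOn_univ
  have hunits := eventually_isInvertible_fibrePart hinv (hθ.self_of_nhdsWithin hz₀)
  obtain ⟨g, hg₀, hg⟩ := exists_hasFDerivWithinAt_of_integrable hS hSi hx₀ (y₀ := y₀)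
    (η := kernelSlope θ)
    (by filter_upwards [hθ, hunits] with z hz hu using contDiffWithinAt_kernelSlope hu hz)
    (by
      filter_upwards [hθ, hunits, hsymm, self_mem_nhdsWithin] with z hz hu hs hzD
      exact fderivWithin_kernelSlope_comm (hD z hzD) hu hz hs)
  have hgraph : Tendsto (fun x => (x, g x)) (𝓝[S] x₀) (𝓝[S ×ˢ univ] (x₀, y₀)) := by
    have hcont : ContinuousWithinAt g S x₀ := (hg.self_of_nhdsWithin hx₀).2.continuousWithinAt
    refine tendsto_nhdsWithin_iff.2 ⟨?_, ?_⟩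
    · exact hg₀ ▸ continuousWithinAt_id.prodMk hcont
    · filter_upwards [self_mem_nhdsWithin] with x hx using ⟨hx, mem_univ _⟩
  refine ⟨g, hg₀, ?_⟩
  filter_upwards [hg, hgraph.eventually hunits] with x hx hu
  exact ⟨hx.2, kernelSlope θ (x, g x), hx.1, apply_kernelSlope hu⟩

end Pfaff

section LinearAlgebra

variable {V U W : Type*} [AddCommGroup V] [Module ℝ V] [AddCommGroup U] [Module ℝ U]
  [AddCommGroup W] [Module ℝ W]

theorem apply_eq_zero_of_not_linearIndependent_map {β : V →ₗ[ℝ] V →ₗ[ℝ] W} (hβ : β.IsAlt)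
    (p : V →ₗ[ℝ] U) (hp : ∀ v, p v = 0 → β v = 0) {v w : V}
    (h : ¬ LinearIndependent ℝ ![p v, p w]) : β v w = 0 := by
  rw [LinearIndependent.pair_iff] at h
  push Not at h
  obtain ⟨s, t, hst, hne⟩ := h
  have hker : β (s • v + t • w) = 0 := hp _ (by simpa only [map_add, map_smul] using hst)
  by_cases hs : s = 0
  · have hw : β w = 0 := by simpa [hs, hne hs] using hker
    rw [← hβ.neg, hw, LinearMap.zero_apply, neg_zero]
  · simpa [hβ w, hs] using LinearMap.congr_fun hker w

theorem linearIndependent_comp_basis_iff {ι : Type*} (b : Module.Basis ι ℝ V) (L : V →ₗ[ℝ] U) :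
    LinearIndependent ℝ (L ∘ b) ↔ Function.Injective L := by
  refine ⟨fun h => ?_, fun h => b.linearIndependent.map' L (LinearMap.ker_eq_bot.2 h)⟩
  have hcomp : Finsupp.linearCombination ℝ (L ∘ b) = L ∘ₗ b.repr.symm.toLinearMap :=
    Finsupp.lhom_ext fun i c => by simp
  rw [LinearIndependent, hcomp] at h
  exact Function.Injective.of_comp_right (f := L) h b.repr.symm.surjective

theorem not_linearIndependent_map_prod {L : ℝ × ℝ →ₗ[ℝ] U}
    (h : ¬ LinearIndependent ℝ ![L (1, 0), L (0, 1)]) (ξ ξ' : ℝ × ℝ) :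
    ¬ LinearIndependent ℝ ![L ξ, L ξ'] := by
  have hcomp : ∀ x y, ![L x, L y] = L ∘ ![x, y] := fun x y => by
    ext i; fin_cases i <;> rfl
  contrapose! h
  rw [hcomp] at h ⊢
  have hξ : LinearIndependent ℝ ![ξ, ξ'] := h.of_comp L
  let b := basisOfLinearIndependentOfCardEqFinrank hξ (by simp)
  have hL : Function.Injective L := (linearIndependent_comp_basis_iff b L).1 (by simpa [b] using h)
  have hbasis : LinearIndependent ℝ ![((1, 0) : ℝ × ℝ), (0, 1)] :=
    LinearIndependent.pair_iff.2 fun s t hst => by simpa using hst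
  exact hbasis.map' L (LinearMap.ker_eq_bot.2 hL)

end LinearAlgebra

section PullbackForm

variable {E' E₁ E V : Type*} [NormedAddCommGroup E'] [NormedSpace ℝ E']
  [NormedAddCommGroup E₁] [NormedSpace ℝ E₁] [NormedAddCommGroup E] [NormedSpace ℝ E]
  [AddCommGroup V] [TopologicalSpace V] [Module ℝ V] {S : Set E'} {x : E'}
  {X : Type*} [TopologicalSpace X] [ChartedSpace E X]
  {A : ∀ p : X, TangentSpace 𝓘(ℝ, E) p →L[ℝ] V} {F : E' → X}

/-- The pullback `F^*A` at `x` of a 1-form `A` on a manifold, along a map `F` defined on a subset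
`S` of a vector space. -/
noncomputable def pullbackForm (A : ∀ p : X, TangentSpace 𝓘(ℝ, E) p →L[ℝ] V) (S : Set E')
    (F : E' → X) (x : E') : E' →L[ℝ] V :=
  A (F x) ∘L mfderivWithin 𝓘(ℝ, E') 𝓘(ℝ, E) F S x

theorem pullbackForm_congr {F' : E' → X} (h : F =ᶠ[𝓝[S] x] F') (hx : F x = F' x) :
    pullbackForm A S F x = pullbackForm A S F' x := by
  have hA : ∀ {p q : X} (_ : p = q) (L : E' →L[ℝ] E),
      (show E →L[ℝ] V from A p) ∘L L = (show E →L[ℝ] V from A q) ∘L L := by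
    rintro p _ rfl L; rfl
  exact (congrArg (A (F x) ∘L ·) (h.mfderivWithin_eq hx)).trans (hA hx _)

theorem pullbackForm_comp {T : Set E₁} {f : E₁ → E'} {y : E₁}
    (hF : MDifferentiableWithinAt 𝓘(ℝ, E') 𝓘(ℝ, E) F S (f y)) (hf : DifferentiableWithinAt ℝ f T y)
    (hfT : MapsTo f T S) (hT : UniqueDiffWithinAt ℝ T y) :
    pullbackForm A T (fun z => F (f z)) y = pullbackForm A S F (f y) ∘L fderivWithin ℝ f T y := by
  have := mfderivWithin_comp y hF hf.mdifferentiableWithinAt hfT hT.uniqueMDiffWithinAt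
  rw [mfderivWithin_eq_fderivWithin] at this
  exact congrArg (A (F (f y)) ∘L ·) this

end PullbackForm

section SmoothForm

variable {E' E V : Type*} [NormedAddCommGroup E'] [NormedSpace ℝ E']
  [NormedAddCommGroup E] [NormedSpace ℝ E] [NormedAddCommGroup V] [NormedSpace ℝ V]
  {S : Set E'} {x : E'}

theorem fderivWithin_comp_clm_fderivWithin_comm (hS : UniqueDiffOn ℝ S) (hx : x ∈ S)
    (hxi : x ∈ closure (interior S)) {Φ : E' → E} (hΦ : ContDiffWithinAt ℝ ∞ Φ S x)
    {a : E → E →L[ℝ] V} (ha : DifferentiableAt ℝ a (Φ x)) {w w' : E'}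
    (hdep : ¬ LinearIndependent ℝ ![fderivWithin ℝ Φ S x w, fderivWithin ℝ Φ S x w']) :
    fderivWithin ℝ (fun y => a (Φ y) ∘L fderivWithin ℝ Φ S y) S x w w' =
      fderivWithin ℝ (fun y => a (Φ y) ∘L fderivWithin ℝ Φ S y) S x w' w := by
  have hΦ' := (hΦ.differentiableWithinAt (by simp)).hasFDerivWithinAt
  have haΦ : HasFDerivWithinAt (fun y => a (Φ y)) (fderiv ℝ a (Φ x) ∘L fderivWithin ℝ Φ S x) S x :=
    ha.hasFDerivAt.comp_hasFDerivWithinAt x hΦ'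
  have hΦ'' := ((hΦ.fderivWithin_right (m := ∞) hS (by simp) hx).differentiableWithinAt
    (by simp)).hasFDerivWithinAt
  have hsymm : IsSymmSndFDerivWithinAt ℝ Φ S x := hΦ.isSymmSndFDerivWithinAt
    (by simpa using WithTop.coe_le_coe.2 (le_top : (2 : ℕ∞) ≤ ⊤)) hS hxi hx
  let β := (fderiv ℝ a (Φ x) - (fderiv ℝ a (Φ x)).flip).toLinearMap₁₂
  have hβ : β (fderivWithin ℝ Φ S x w) (fderivWithin ℝ Φ S x w') = 0 :=
    apply_eq_zero_of_not_linearIndependent_map (fun v => sub_self _) LinearMap.id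
      (by rintro v rfl; exact map_zero β) hdep
  rw [(haΦ.clm_comp hΦ'').fderivWithin (hS x hx)]
  simp only [add_apply, ContinuousLinearMap.comp_apply, ContinuousLinearMap.compL_apply,
    ContinuousLinearMap.flip_apply]
  rw [hsymm w w']
  exact congrArg _ (sub_eq_zero.1 hβ)

variable {X : Type*} [TopologicalSpace X] [ChartedSpace E X] [IsManifold 𝓘(ℝ, E) ∞ X]
  {A : ∀ p : X, TangentSpace 𝓘(ℝ, E) p →L[ℝ] V} {F : E' → X}

/-- A 1-form is smooth if it is smooth as a section of the bundle of linear maps `TX → V`. -/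
def IsSmoothForm (A : ∀ p : X, TangentSpace 𝓘(ℝ, E) p →L[ℝ] V) : Prop :=
  ContMDiff 𝓘(ℝ, E) (𝓘(ℝ, E).prod 𝓘(ℝ, E →L[ℝ] V)) ∞
    (fun p => Bundle.TotalSpace.mk' (E →L[ℝ] V)
      (E := fun p : X => TangentSpace 𝓘(ℝ, E) p →L[ℝ] Bundle.Trivial X V p) p (A p))

theorem mdifferentiableAt_extChartAt_symm {p₀ : X} {e : E}
    (he : e ∈ (extChartAt 𝓘(ℝ, E) p₀).target) :
    MDifferentiableAt 𝓘(ℝ, E) 𝓘(ℝ, E) (extChartAt 𝓘(ℝ, E) p₀).symm e :=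
  ((contMDiffOn_extChartAt_symm (n := ∞) p₀).contMDiffAt
    ((isOpen_extChartAt_target p₀).mem_nhds he)).mdifferentiableAt (by simp)

theorem pullbackForm_eq_comp_extChartAt {p₀ : X} (hx : F x ∈ (extChartAt 𝓘(ℝ, E) p₀).source)
    (hF : MDifferentiableWithinAt 𝓘(ℝ, E') 𝓘(ℝ, E) F S x) (hS : UniqueDiffWithinAt ℝ S x) :
    pullbackForm A S F x =
      pullbackForm A univ (extChartAt 𝓘(ℝ, E) p₀).symm (extChartAt 𝓘(ℝ, E) p₀ (F x)) ∘L
        fderivWithin ℝ (extChartAt 𝓘(ℝ, E) p₀ ∘ F) S x := by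
  have : IsManifold 𝓘(ℝ, E) 1 X := IsManifold.of_le (n := ∞) (by simp)
  have hψF : DifferentiableWithinAt ℝ (extChartAt 𝓘(ℝ, E) p₀ ∘ F) S x :=
    ((mdifferentiableAt_extChartAt
      (by rwa [← extChartAt_source 𝓘(ℝ, E)])).comp_mdifferentiableWithinAt x
        hF).differentiableWithinAt
  have hψ := mdifferentiableAt_extChartAt_symm ((extChartAt 𝓘(ℝ, E) p₀).map_source hx)
  refine Eq.trans ?_ (pullbackForm_comp (f := extChartAt 𝓘(ℝ, E) p₀ ∘ F)
    hψ.mdifferentiableWithinAt hψF (mapsTo_univ _ _) hS)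
  refine pullbackForm_congr ?_ ((extChartAt 𝓘(ℝ, E) p₀).left_inv hx).symm
  filter_upwards [hF.continuousWithinAt.preimage_mem_nhdsWithin (extChartAt_source_mem_nhds' hx)]
    with y hy using ((extChartAt 𝓘(ℝ, E) p₀).left_inv hy).symm

theorem IsSmoothForm.contDiffAt_pullbackForm_extChartAt_symm (hA : IsSmoothForm A) (p₀ : X) :
    ContDiffAt ℝ ∞ (pullbackForm A univ (extChartAt 𝓘(ℝ, E) p₀).symm)
      (extChartAt 𝓘(ℝ, E) p₀ p₀) := by
  have : IsManifold 𝓘(ℝ, E) 1 X := IsManifold.of_le (n := ∞) (by simp)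
  have hp₀ : (extChartAt 𝓘(ℝ, E) p₀).symm (extChartAt 𝓘(ℝ, E) p₀ p₀) = p₀ := extChartAt_to_inv p₀
  have hψ : ContMDiffAt 𝓘(ℝ, E) 𝓘(ℝ, E) ∞ (extChartAt 𝓘(ℝ, E) p₀).symm
      (extChartAt 𝓘(ℝ, E) p₀ p₀) :=
    (contMDiffOn_extChartAt_symm p₀).contMDiffAt (extChartAt_target_mem_nhds p₀)
  refine (((contMDiffAt_hom_bundle _).1
    (hA p₀)).2.comp_of_eq hψ hp₀).contDiffAt.congr_of_eventuallyEq ?_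
  filter_upwards [extChartAt_target_mem_nhds p₀] with e he
  have hsrc : (extChartAt 𝓘(ℝ, E) p₀).symm e ∈ (chartAt E p₀).source := by
    rw [← extChartAt_source 𝓘(ℝ, E)]; exact (extChartAt 𝓘(ℝ, E) p₀).map_target he
  have := TangentBundle.symmL_trivializationAt (I := 𝓘(ℝ, E)) hsrc
  rw [(extChartAt 𝓘(ℝ, E) p₀).right_inv he] at this
  simp only [pullbackForm, Function.comp_apply, ContinuousLinearMap.inCoordinates, this]
  ext v
  simp [Bundle.Trivial.continuousLinearMapAt_trivialization]

theorem pullbackForm_eventuallyEq (hS : UniqueDiffOn ℝ S) (hx : x ∈ S)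
    (hF : ContMDiffWithinAt 𝓘(ℝ, E') 𝓘(ℝ, E) ∞ F S x) :
    pullbackForm A S F =ᶠ[𝓝[S] x] fun y =>
      pullbackForm A univ (extChartAt 𝓘(ℝ, E) (F x)).symm (extChartAt 𝓘(ℝ, E) (F x) (F y)) ∘L
        fderivWithin ℝ (extChartAt 𝓘(ℝ, E) (F x) ∘ F) S y := by
  have : IsManifold 𝓘(ℝ, E) 1 X := IsManifold.of_le (n := ∞) (by simp)
  have hF₁ : ContMDiffWithinAt 𝓘(ℝ, E') 𝓘(ℝ, E) 1 F S x := hF.of_le (by simp)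
  have hev : ∀ᶠ y in 𝓝[S] x, ContMDiffWithinAt 𝓘(ℝ, E') 𝓘(ℝ, E) 1 F S y := by
    simpa only [insert_eq_of_mem hx] using
      (contMDiffWithinAt_iff_contMDiffWithinAt_nhdsWithin (by simp)).1 hF₁
  filter_upwards [hev, self_mem_nhdsWithin,
    hF.continuousWithinAt.preimage_mem_nhdsWithin (extChartAt_source_mem_nhds (I := 𝓘(ℝ, E)) (F x))]
    with y hy hyS hysrc
  exact pullbackForm_eq_comp_extChartAt hysrc (hy.mdifferentiableWithinAt (by simp)) (hS y hyS)

theorem IsSmoothForm.contDiffWithinAt_pullbackForm (hA : IsSmoothForm A) (hS : UniqueDiffOn ℝ S)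
    (hx : x ∈ S) (hF : ContMDiffWithinAt 𝓘(ℝ, E') 𝓘(ℝ, E) ∞ F S x) :
    ContDiffWithinAt ℝ ∞ (pullbackForm A S F) S x := by
  have hψF : ContDiffWithinAt ℝ ∞ (extChartAt 𝓘(ℝ, E) (F x) ∘ F) S x :=
    (contMDiffAt_extChartAt.comp_contMDiffWithinAt x hF).contDiffWithinAt
  exact ContDiffWithinAt.congr_of_eventuallyEq_of_mem
    (((hA.contDiffAt_pullbackForm_extChartAt_symm (F x)).comp_contDiffWithinAt x hψF).clm_comp
      (hψF.fderivWithin_right (m := ∞) hS (by simp) hx)) (pullbackForm_eventuallyEq hS hx hF) hx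

theorem IsSmoothForm.fderivWithin_pullbackForm_comm (hA : IsSmoothForm A) (hS : UniqueDiffOn ℝ S)
    (hx : x ∈ S) (hxi : x ∈ closure (interior S))
    (hF : ContMDiffWithinAt 𝓘(ℝ, E') 𝓘(ℝ, E) ∞ F S x) {w w' : E'}
    (hdep : ¬ LinearIndependent ℝ (M := TangentSpace 𝓘(ℝ, E) (F x))
      ![mfderivWithin 𝓘(ℝ, E') 𝓘(ℝ, E) F S x w, mfderivWithin 𝓘(ℝ, E') 𝓘(ℝ, E) F S x w']) :
    fderivWithin ℝ (pullbackForm A S F) S x w w' =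
      fderivWithin ℝ (pullbackForm A S F) S x w' w := by
  have hψ : ContMDiffAt 𝓘(ℝ, E) 𝓘(ℝ, E) ∞ (extChartAt 𝓘(ℝ, E) (F x)) (F x) :=
    contMDiffAt_extChartAt
  have hψF := (hψ.comp_contMDiffWithinAt x hF).contDiffWithinAt
  have hchain : ∀ v, fderivWithin ℝ (extChartAt 𝓘(ℝ, E) (F x) ∘ F) S x v =
      mfderiv 𝓘(ℝ, E) 𝓘(ℝ, E) (extChartAt 𝓘(ℝ, E) (F x)) (F x)
        (mfderivWithin 𝓘(ℝ, E') 𝓘(ℝ, E) F S x v) := fun v => by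
    rw [← mfderivWithin_eq_fderivWithin, mfderiv_comp_mfderivWithin x
      (hψ.mdifferentiableAt (by simp)) (hF.mdifferentiableWithinAt (by simp))
      (hS x hx).uniqueMDiffWithinAt]
    rfl
  rw [(pullbackForm_eventuallyEq hS hx hF).fderivWithin_eq_of_mem hx]
  refine fderivWithin_comp_clm_fderivWithin_comm hS hx hxi hψF
    ((hA.contDiffAt_pullbackForm_extChartAt_symm (F x)).differentiableAt (by simp)) fun h => ?_
  rw [hchain, hchain] at h
  have hcomp : ∀ (L : E →L[ℝ] E) (a b : E), ![L a, L b] = L ∘ ![a, b] := fun L a b => by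
    ext i; fin_cases i <;> rfl
  exact hdep ((hcomp _ _ _ ▸ h : LinearIndependent ℝ _).of_comp
    (mfderiv 𝓘(ℝ, E) 𝓘(ℝ, E) (extChartAt 𝓘(ℝ, E) (F x)) (F x)).toLinearMap)

end SmoothForm

section MaurerCartan

variable {EG : Type*} [NormedAddCommGroup EG] [NormedSpace ℝ EG]
  {G : Type*} [TopologicalSpace G] [ChartedSpace EG G] [Group G]

/-- The left Maurer–Cartan form of `G`. -/
noncomputable def maurerCartan (k : G) :
    TangentSpace 𝓘(ℝ, EG) k →L[ℝ] GroupLieAlgebra 𝓘(ℝ, EG) G :=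
  mfderiv 𝓘(ℝ, EG) 𝓘(ℝ, EG) (fun g : G => k⁻¹ * g) k

theorem isInvertible_maurerCartan [LieGroup 𝓘(ℝ, EG) ∞ G] (k : G) :
    (maurerCartan k : TangentSpace 𝓘(ℝ, EG) k →L[ℝ] _).IsInvertible := by
  have hmul : ∀ a b : G, MDifferentiableAt 𝓘(ℝ, EG) 𝓘(ℝ, EG) (a * ·) b := fun a b =>
    (contMDiff_mul_left (n := ∞)).mdifferentiable (by simp) b
  have hid : ∀ {a b c d : G}, a * b = 1 → b * c = d →
      mfderiv 𝓘(ℝ, EG) 𝓘(ℝ, EG) (a * ·) d ∘L mfderiv 𝓘(ℝ, EG) 𝓘(ℝ, EG) (b * ·) c = .id ℝ EG := by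
    intro a b c d hab hbc
    have hcomp : (a * ·) ∘ (b * ·) = @id G := by
      funext g
      simp only [Function.comp_apply, ← mul_assoc, hab, one_mul, id]
    subst hbc
    exact (mfderiv_comp c (hmul a _) (hmul b c)).symm.trans (by rw [hcomp]; exact mfderiv_id)
  exact ContinuousLinearMap.IsInvertible.of_inverse
    (hid (inv_mul_cancel k) (mul_one k)) (hid (mul_inv_cancel k) (inv_mul_cancel k))

end MaurerCartan

section PrincipalBundle

variable {EG : Type*} [NormedAddCommGroup EG] [NormedSpace ℝ EG]
  {G : Type*} [TopologicalSpace G] [ChartedSpace EG G] [Group G]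
  {EM : Type*} [NormedAddCommGroup EM] [NormedSpace ℝ EM]
  {M : Type*} [TopologicalSpace M] [ChartedSpace EM M]
  {EP : Type*} [NormedAddCommGroup EP] [NormedSpace ℝ EP]
  {P : Type*} [TopologicalSpace P] [ChartedSpace EP P] [MulAction Gᵐᵒᵖ P] {π : P → M}

/-- A local trivialization `φ` enters through the section `σ u = φ (u, 1)` and the fibre
coordinate `k`, which recover a point by `q = σ (π q) · k q`. -/
theorem IsPrincipalBundle.exists_section (hπ : IsPrincipalBundle EG EM EP G π) (x : M) :
    ∃ U : Set M, IsOpen U ∧ x ∈ U ∧ ∃ (σ : M → P) (k : P → G),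
      ContMDiffOn 𝓘(ℝ, EM) 𝓘(ℝ, EP) ∞ σ U ∧ ContMDiffOn 𝓘(ℝ, EP) 𝓘(ℝ, EG) ∞ k (π ⁻¹' U) ∧
      (∀ q ∈ π ⁻¹' U, σ (π q) <• k q = q) ∧ ∀ u ∈ U, π (σ u) = u := by
  obtain ⟨U, hU, hxU, φ, hsrc, htgt, hφ, hφs, hφa⟩ := hπ.locally_trivial x
  refine ⟨U, hU, hxU, fun x => φ (x, 1), fun q => (φ.symm q).2, ?_, ?_, fun q hq => ?_,
    fun u hu => (hφa u hu 1 1).2⟩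
  · refine hφ.comp (f := fun x : M => (x, (1 : G)))
      (contMDiff_id.prodMk contMDiff_const).contMDiffOn fun u hu => ?_
    rw [mem_preimage, hsrc]
    exact ⟨hu, mem_univ _⟩
  · rw [← htgt]
    exact contMDiff_snd.comp_contMDiffOn hφs
  · have hq' : q ∈ φ.target := htgt ▸ hq
    have hmem : (φ.symm q).1 ∈ U := (hsrc ▸ φ.map_target hq' : φ.symm q ∈ U ×ˢ univ).1
    have hproj : π q = (φ.symm q).1 := by
      simpa only [Prod.mk.eta, φ.right_inv hq'] using (hφa _ hmem (φ.symm q).2 1).2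
    rw [hproj, (hφa _ hmem 1 _).1, one_mul, Prod.mk.eta, φ.right_inv hq']

theorem mdifferentiableAt_orbit
    (hact : ContMDiff (𝓘(ℝ, EP).prod 𝓘(ℝ, EG)) 𝓘(ℝ, EP) ∞ (fun x : P × G => x.1 <• x.2))
    (p : P) (k : G) : MDifferentiableAt 𝓘(ℝ, EG) 𝓘(ℝ, EP) (fun g : G => p <• g) k :=
  (hact.comp (contMDiff_const.prodMk contMDiff_id)).mdifferentiable (by simp) k

theorem mfderiv_orbit [LieGroup 𝓘(ℝ, EG) ∞ G]
    (hact : ContMDiff (𝓘(ℝ, EP).prod 𝓘(ℝ, EG)) 𝓘(ℝ, EP) ∞ (fun x : P × G => x.1 <• x.2))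
    (p : P) (k : G) (ζ : TangentSpace 𝓘(ℝ, EG) k) :
    mfderiv 𝓘(ℝ, EG) 𝓘(ℝ, EP) (fun g : G => p <• g) k ζ =
      fundamental EP (p <• k) (maurerCartan k ζ) := by
  have hfun : (fun g : G => p <• g) = (fun h : G => (p <• k) <• h) ∘ fun g => k⁻¹ * g := by
    funext g
    simp only [Function.comp_apply, smul_smul, ← MulOpposite.op_mul, mul_inv_cancel_left]
  have hcomp : mfderiv 𝓘(ℝ, EG) 𝓘(ℝ, EP) ((fun h : G => (p <• k) <• h) ∘ fun g => k⁻¹ * g) k =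
      mfderiv 𝓘(ℝ, EG) 𝓘(ℝ, EP) (fun h : G => (p <• k) <• h) 1 ∘L
        mfderiv 𝓘(ℝ, EG) 𝓘(ℝ, EG) (fun g : G => k⁻¹ * g) k := by
    rw [mfderiv_comp_of_eq (mdifferentiableAt_orbit hact (p <• k) 1)
      ((contMDiff_mul_left (I := 𝓘(ℝ, EG)) (n := ∞)).mdifferentiable (by simp) k)
      (inv_mul_cancel k)]
    congr 1
    rw [inv_mul_cancel]
  rw [hfun]
  exact congrArg (fun L : EG →L[ℝ] EP => L ζ) hcomp

theorem hasMFDerivWithinAt_act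
    (hact : ContMDiff (𝓘(ℝ, EP).prod 𝓘(ℝ, EG)) 𝓘(ℝ, EP) ∞ (fun x : P × G => x.1 <• x.2))
    {EN : Type*} [NormedAddCommGroup EN] [NormedSpace ℝ EN]
    {N : Type*} [TopologicalSpace N] [ChartedSpace EN N] {F : N → P} {k : N → G} {S : Set N}
    {x : N} {F' : TangentSpace 𝓘(ℝ, EN) x →L[ℝ] TangentSpace 𝓘(ℝ, EP) (F x)}
    {k' : TangentSpace 𝓘(ℝ, EN) x →L[ℝ] TangentSpace 𝓘(ℝ, EG) (k x)}
    (hF : HasMFDerivWithinAt 𝓘(ℝ, EN) 𝓘(ℝ, EP) F S x F')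
    (hk : HasMFDerivWithinAt 𝓘(ℝ, EN) 𝓘(ℝ, EG) k S x k') :
    HasMFDerivWithinAt 𝓘(ℝ, EN) 𝓘(ℝ, EP) (fun y => F y <• k y) S x
      (rightMap EP (F x) (k x) ∘L F' +
        mfderiv 𝓘(ℝ, EG) 𝓘(ℝ, EP) (fun g : G => F x <• g) (k x) ∘L k') := by
  have hd : MDifferentiableAt (𝓘(ℝ, EP).prod 𝓘(ℝ, EG)) 𝓘(ℝ, EP)
      (fun x : P × G => x.1 <• x.2) (F x, k x) := hact.mdifferentiable (by simp) _
  have hsplit : rightMap EP (F x) (k x) ∘L F' +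
      mfderiv 𝓘(ℝ, EG) 𝓘(ℝ, EP) (fun g : G => F x <• g) (k x) ∘L k' =
      mfderiv (𝓘(ℝ, EP).prod 𝓘(ℝ, EG)) 𝓘(ℝ, EP) (fun x : P × G => x.1 <• x.2) (F x, k x) ∘L
        F'.prod k' := by
    ext ξ
    exact (mfderiv_prod_eq_add_apply
      (v := ((F' ξ, k' ξ) : TangentSpace (𝓘(ℝ, EP).prod 𝓘(ℝ, EG)) (F x, k x))) hd).symm
  rw [hsplit]
  exact hd.hasMFDerivAt.comp_hasMFDerivWithinAt x (hF.prodMk hk)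

theorem IsPrincipalBundle.exists_eq_fundamental [LieGroup 𝓘(ℝ, EG) ∞ G]
    (hπ : IsPrincipalBundle EG EM EP G π) {p : P} {v : TangentSpace 𝓘(ℝ, EP) p}
    (hv : mfderiv 𝓘(ℝ, EP) 𝓘(ℝ, EM) π p v = 0) :
    ∃ Y : GroupLieAlgebra 𝓘(ℝ, EG) G, v = fundamental EP p Y := by
  obtain ⟨U, hU, hpU, σ, k, hσ, hk, hσk, -⟩ := hπ.exists_section (π p)
  have hUp : π ⁻¹' U ∈ 𝓝 p := (hU.preimage hπ.smooth_proj.continuous).mem_nhds hpU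
  have hσπ := ((hσ.contMDiffAt (hU.mem_nhds hpU)).mdifferentiableAt (by simp)).hasMFDerivAt.comp p
    (hπ.smooth_proj.mdifferentiable (by simp) p).hasMFDerivAt
  have hkp := ((hk.contMDiffAt hUp).mdifferentiableAt (by simp)).hasMFDerivAt
  have hd := hasMFDerivWithinAt_act hπ.smooth_act
    (hσπ.hasMFDerivWithinAt (s := univ)) (hkp.hasMFDerivWithinAt (s := univ))
  rw [hasMFDerivWithinAt_univ] at hd
  have hid := hasMFDerivAt_unique (hasMFDerivAt_id p) (hd.congr_of_eventuallyEq (f₁ := id)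
    (by filter_upwards [hUp] with q hq using (hσk q hq).symm))
  have hsplit : (v : EP) = fundamental (G := G) EP (σ (π p) <• k p)
      (maurerCartan (k p) (mfderiv 𝓘(ℝ, EP) 𝓘(ℝ, EG) k p v)) := by
    rw [← mfderiv_orbit hπ.smooth_act]
    refine (congrArg (fun L : EP →L[ℝ] EP => L v) hid).trans (add_eq_right.2 ?_)
    have hσv : mfderiv 𝓘(ℝ, EM) 𝓘(ℝ, EP) σ (π p) (mfderiv 𝓘(ℝ, EP) 𝓘(ℝ, EM) π p v) = 0 := by
      rw [hv, map_zero]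
    exact (congrArg (rightMap EP (σ (π p)) (k p)) hσv).trans (map_zero _)
  rw [hσk p hpU] at hsplit
  exact ⟨_, hsplit⟩

variable {E' : Type*} [NormedAddCommGroup E'] [NormedSpace ℝ E']
  [IsManifold 𝓘(ℝ, EP) ∞ P] [LieGroup 𝓘(ℝ, EG) ∞ G]
  {A : ∀ p : P, TangentSpace 𝓘(ℝ, EP) p →L[ℝ] GroupLieAlgebra 𝓘(ℝ, EG) G}

theorem IsConnectionForm.pullbackForm_act (hA : IsConnectionForm A)
    (hact : ContMDiff (𝓘(ℝ, EP).prod 𝓘(ℝ, EG)) 𝓘(ℝ, EP) ∞ (fun x : P × G => x.1 <• x.2))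
    {S : Set E'} {x : E'} (hS : UniqueDiffWithinAt ℝ S x) {F : E' → P} {k : E' → G}
    (hF : MDifferentiableWithinAt 𝓘(ℝ, E') 𝓘(ℝ, EP) F S x)
    (hk : MDifferentiableWithinAt 𝓘(ℝ, E') 𝓘(ℝ, EG) k S x) :
    pullbackForm A S (fun y => F y <• k y) x =
      Ad (k x)⁻¹ ∘L pullbackForm A S F x + pullbackForm maurerCartan S k x := by
  ext ξ
  have hd := (hasMFDerivWithinAt_act hact hF.hasMFDerivWithinAt
    hk.hasMFDerivWithinAt).mfderivWithin hS.uniqueMDiffWithinAt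
  refine (congrArg (fun L : E' →L[ℝ] EP => A (F x <• k x) (L ξ)) hd).trans ?_
  refine (map_add (A (F x <• k x)) _ _).trans (congrArg₂ _ (hA.equivariant _ _ _) ?_)
  exact (congrArg _ (mfderiv_orbit hact _ _ _)).trans (hA.vertical _ _)

theorem IsConnectionForm.eq_zero_of_vertical (hA : IsConnectionForm A)
    (hπ : IsPrincipalBundle EG EM EP G π) {p : P} {v : TangentSpace 𝓘(ℝ, EP) p}
    (hv : mfderiv 𝓘(ℝ, EP) 𝓘(ℝ, EM) π p v = 0) (hAv : A p v = 0) : v = 0 := by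
  obtain ⟨Y, rfl⟩ := hπ.exists_eq_fundamental hv
  rw [← hA.vertical p Y, hAv]
  exact map_zero (mfderiv 𝓘(ℝ, EG) 𝓘(ℝ, EP) (fun g : G => p <• g) 1)

theorem IsConnectionForm.not_linearIndependent_of_horizontal (hA : IsConnectionForm A)
    (hπ : IsPrincipalBundle EG EM EP G π) {p : P} {v w : TangentSpace 𝓘(ℝ, EP) p}
    (hv : A p v = 0) (hw : A p w = 0)
    (h : ¬ LinearIndependent ℝ (M := TangentSpace 𝓘(ℝ, EM) (π p))
      ![mfderiv 𝓘(ℝ, EP) 𝓘(ℝ, EM) π p v, mfderiv 𝓘(ℝ, EP) 𝓘(ℝ, EM) π p w]) :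
    ¬ LinearIndependent ℝ ![v, w] := by
  rw [LinearIndependent.pair_iff] at h ⊢
  contrapose! h
  intro s t hst
  refine h s t (hA.eq_zero_of_vertical hπ ?_ ?_)
  · rw [map_add, map_smul, map_smul]; exact hst
  · rw [map_add, map_smul, map_smul, hv, hw, smul_zero, smul_zero, add_zero]

end PrincipalBundle

theorem eventually_eq_of_hasMFDerivWithinAt_zero {E' E : Type*} [NormedAddCommGroup E']
    [NormedSpace ℝ E'] [NormedAddCommGroup E] [NormedSpace ℝ E] {X : Type*} [TopologicalSpace X]
    [ChartedSpace E X] [IsManifold 𝓘(ℝ, E) 1 X] {S : Set E'} (hS : Convex ℝ S) {k : E' → X}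
    {x : E'} (hx : x ∈ S) (hk : ∀ᶠ y in 𝓝[S] x, HasMFDerivWithinAt 𝓘(ℝ, E') 𝓘(ℝ, E) k S y 0) :
    ∀ᶠ y in 𝓝[S] x, k y = k x := by
  have hsrc : ∀ᶠ y in 𝓝[S] x, k y ∈ (chartAt E (k x)).source :=
    (hk.self_of_nhdsWithin hx).continuousWithinAt.eventually
      ((chartAt E (k x)).open_source.mem_nhds (mem_chart_source E (k x)))
  obtain ⟨ε, hε, hball⟩ := Metric.mem_nhdsWithin_iff.1 (hk.and hsrc)
  have hderiv : ∀ y ∈ ball x ε ∩ S,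
      HasFDerivWithinAt (extChartAt 𝓘(ℝ, E) (k x) ∘ k) (0 : E' →L[ℝ] E) (ball x ε ∩ S) y := by
    intro y hy
    have hcomp := (mdifferentiableAt_extChartAt (I := 𝓘(ℝ, E))
      (hball hy).2).hasMFDerivAt.comp_hasMFDerivWithinAt y (hball hy).1
    rw [ContinuousLinearMap.comp_zero] at hcomp
    exact (hasMFDerivWithinAt_iff_hasFDerivWithinAt.1 hcomp).mono inter_subset_right
  filter_upwards [inter_mem (mem_nhdsWithin_of_mem_nhds (ball_mem_nhds x hε)) self_mem_nhdsWithin]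
    with y hy
  have hnorm := ((convex_ball x ε).inter hS).norm_image_sub_le_of_norm_hasFDerivWithin_le hderiv
    (C := 0) (fun y _ => by simp) ⟨mem_ball_self hε, hx⟩ hy
  rw [zero_mul, norm_le_zero_iff, sub_eq_zero] at hnorm
  refine (extChartAt 𝓘(ℝ, E) (k x)).injOn ?_ (mem_extChartAt_source (k x)) hnorm
  rw [extChartAt_source]
  exact (hball hy).2

section HorizontalAt

variable {EG : Type*} [NormedAddCommGroup EG] [NormedSpace ℝ EG]
  {G : Type*} [TopologicalSpace G] [ChartedSpace EG G] [Group G]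
  {EP : Type*} [NormedAddCommGroup EP] [NormedSpace ℝ EP]
  {P : Type*} [TopologicalSpace P] [ChartedSpace EP P]
  {E' : Type*} [NormedAddCommGroup E'] [NormedSpace ℝ E']
  {E₁ : Type*} [NormedAddCommGroup E₁] [NormedSpace ℝ E₁]

/-- A map `F : S → P` is horizontal at `x` if it is smooth at `x` and its derivative there takes
horizontal values. -/
structure IsHorizontalAt (A : ∀ p : P, TangentSpace 𝓘(ℝ, EP) p →L[ℝ] GroupLieAlgebra 𝓘(ℝ, EG) G)
    (S : Set E') (F : E' → P) (x : E') : Prop where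
  smooth : ContMDiffWithinAt 𝓘(ℝ, E') 𝓘(ℝ, EP) ∞ F S x
  pullbackForm_eq_zero : pullbackForm A S F x = 0

variable {A : ∀ p : P, TangentSpace 𝓘(ℝ, EP) p →L[ℝ] GroupLieAlgebra 𝓘(ℝ, EG) G}
  {S : Set E'} {F F₁ F₂ : E' → P} {x : E'}

theorem IsHorizontalAt.mdifferentiableWithinAt (h : IsHorizontalAt A S F x) :
    MDifferentiableWithinAt 𝓘(ℝ, E') 𝓘(ℝ, EP) F S x :=
  h.smooth.mdifferentiableWithinAt (by simp)

theorem IsHorizontalAt.congr (h : IsHorizontalAt A S F x) (he : F₁ =ᶠ[𝓝[S] x] F)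
    (hx : F₁ x = F x) : IsHorizontalAt A S F₁ x :=
  ⟨h.smooth.congr_of_eventuallyEq he hx,
    (pullbackForm_congr he hx).trans h.pullbackForm_eq_zero⟩

theorem isHorizontalAt_inter_iff {W : Set E'} (hW : W ∈ 𝓝 x) :
    IsHorizontalAt A (S ∩ W) F x ↔ IsHorizontalAt A S F x := by
  have hsmooth := contMDiffWithinAt_inter (I := 𝓘(ℝ, E')) (I' := 𝓘(ℝ, EP)) (n := ∞) (f := F)
    (s := S) hW
  have hpull : pullbackForm A (S ∩ W) F x = pullbackForm A S F x :=
    congrArg (A (F x) ∘L ·) (mfderivWithin_inter hW)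
  exact ⟨fun h => ⟨hsmooth.1 h.1, hpull.symm.trans h.2⟩,
    fun h => ⟨hsmooth.2 h.1, hpull.trans h.2⟩⟩

theorem IsHorizontalAt.comp {T : Set E₁} {f : E₁ → E'} {y : E₁} (h : IsHorizontalAt A S F (f y))
    (hf : ContDiffWithinAt ℝ ∞ f T y) (hfT : MapsTo f T S) (hT : UniqueDiffWithinAt ℝ T y) :
    IsHorizontalAt A T (fun z => F (f z)) y := by
  refine ⟨h.smooth.comp y hf.contMDiffWithinAt hfT, ?_⟩
  rw [pullbackForm_comp h.mdifferentiableWithinAt (hf.differentiableWithinAt (by simp)) hfT hT,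
    h.pullbackForm_eq_zero, ContinuousLinearMap.zero_comp]

theorem isHorizontalAt_const (p : P) : IsHorizontalAt A S (fun _ => p) x :=
  ⟨contMDiffWithinAt_const, (congrArg (A p ∘L ·) mfderivWithin_const).trans
    (ContinuousLinearMap.comp_zero _)⟩

variable [MulAction Gᵐᵒᵖ P]
  {EM : Type*} [NormedAddCommGroup EM] [NormedSpace ℝ EM]
  {M : Type*} [TopologicalSpace M] [ChartedSpace EM M] {π : P → M}

theorem IsPrincipalBundle.exists_smooth_eq_act [LieGroup 𝓘(ℝ, EG) ∞ G]
    (hπ : IsPrincipalBundle EG EM EP G π)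
    (h₁ : ∀ᶠ y in 𝓝[S] x, ContMDiffWithinAt 𝓘(ℝ, E') 𝓘(ℝ, EP) ∞ F₁ S y)
    (h₂ : ∀ᶠ y in 𝓝[S] x, ContMDiffWithinAt 𝓘(ℝ, E') 𝓘(ℝ, EP) ∞ F₂ S y) (hx : x ∈ S)
    (he : ∀ᶠ y in 𝓝[S] x, π (F₁ y) = π (F₂ y)) :
    ∃ κ : E' → G, ∀ᶠ y in 𝓝[S] x,
      ContMDiffWithinAt 𝓘(ℝ, E') 𝓘(ℝ, EG) ∞ κ S y ∧ F₂ y = F₁ y <• κ y := by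
  obtain ⟨U, hU, hxU, σ, k, -, hk, hσk, -⟩ := hπ.exists_section (π (F₁ x))
  have hUo : IsOpen (π ⁻¹' U) := hU.preimage hπ.smooth_proj.continuous
  have hU₁ : ∀ᶠ y in 𝓝[S] x, F₁ y ∈ π ⁻¹' U :=
    (h₁.self_of_nhdsWithin hx).continuousWithinAt.eventually (hUo.mem_nhds hxU)
  refine ⟨fun y => (k (F₁ y))⁻¹ * k (F₂ y), ?_⟩
  filter_upwards [h₁, h₂, hU₁, he] with y hy₁ hy₂ hyU hye
  have hyU₂ : F₂ y ∈ π ⁻¹' U := by rwa [mem_preimage, ← hye]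
  have hk₁ : ContMDiffWithinAt 𝓘(ℝ, E') 𝓘(ℝ, EG) ∞ (fun z => k (F₁ z)) S y :=
    (hk.contMDiffAt (hUo.mem_nhds hyU)).comp_contMDiffWithinAt y hy₁
  have hk₂ : ContMDiffWithinAt 𝓘(ℝ, E') 𝓘(ℝ, EG) ∞ (fun z => k (F₂ z)) S y :=
    (hk.contMDiffAt (hUo.mem_nhds hyU₂)).comp_contMDiffWithinAt y hy₂
  refine ⟨hk₁.inv.mul hk₂, ?_⟩
  calc F₂ y = σ (π (F₁ y)) <• k (F₂ y) := by rw [hye, hσk _ hyU₂]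
    _ = (σ (π (F₁ y)) <• k (F₁ y)) <• ((k (F₁ y))⁻¹ * k (F₂ y)) := by
        simp only [smul_smul, ← MulOpposite.op_mul, mul_inv_cancel_left]
    _ = F₁ y <• ((k (F₁ y))⁻¹ * k (F₂ y)) := by rw [hσk _ hyU]

variable [IsManifold 𝓘(ℝ, EP) ∞ P] [LieGroup 𝓘(ℝ, EG) ∞ G]

theorem IsHorizontalAt.act (h : IsHorizontalAt A S F x) (hA : IsConnectionForm A)
    (hact : ContMDiff (𝓘(ℝ, EP).prod 𝓘(ℝ, EG)) 𝓘(ℝ, EP) ∞ (fun x : P × G => x.1 <• x.2))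
    (hS : UniqueDiffWithinAt ℝ S x) (c : G) : IsHorizontalAt A S (fun y => F y <• c) x := by
  refine ⟨(hact.contMDiffAt (x := (F x, c))).comp_contMDiffWithinAt x
    (f := fun y => (F y, c)) (h.smooth.prodMk contMDiffWithinAt_const), ?_⟩
  have hconst : pullbackForm maurerCartan S (fun _ => c) x = 0 :=
    (congrArg (maurerCartan (EG := EG) c ∘L ·) mfderivWithin_const).trans
      (ContinuousLinearMap.comp_zero _)
  rw [hA.pullbackForm_act hact hS h.mdifferentiableWithinAt mdifferentiableWithinAt_const,
    h.pullbackForm_eq_zero, hconst, ContinuousLinearMap.comp_zero, add_zero]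

theorem IsHorizontalAt.mfderivWithin_eq_zero_of_eq_act (h₁ : IsHorizontalAt A S F₁ x)
    (h₂ : IsHorizontalAt A S F₂ x) (hA : IsConnectionForm A)
    (hact : ContMDiff (𝓘(ℝ, EP).prod 𝓘(ℝ, EG)) 𝓘(ℝ, EP) ∞ (fun x : P × G => x.1 <• x.2))
    (hS : UniqueDiffWithinAt ℝ S x) {κ : E' → G}
    (hκ : MDifferentiableWithinAt 𝓘(ℝ, E') 𝓘(ℝ, EG) κ S x)
    (he : F₂ =ᶠ[𝓝[S] x] fun y => F₁ y <• κ y) (hx : F₂ x = F₁ x <• κ x) :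
    mfderivWithin 𝓘(ℝ, E') 𝓘(ℝ, EG) κ S x = 0 := by
  have hzero := hA.pullbackForm_act hact hS h₁.mdifferentiableWithinAt hκ
  rw [← pullbackForm_congr he hx, h₁.pullbackForm_eq_zero, h₂.pullbackForm_eq_zero,
    ContinuousLinearMap.comp_zero, zero_add] at hzero
  ext ξ
  exact (isInvertible_maurerCartan (κ x)).injective
    ((congrArg (fun L : E' →L[ℝ] EG => L ξ) hzero.symm).trans (map_zero _).symm)

theorem IsHorizontalAt.exists_eventually_eq_act (hA : IsConnectionForm A)
    (hπ : IsPrincipalBundle EG EM EP G π) (hS : Convex ℝ S) (hSu : UniqueDiffOn ℝ S) (hx : x ∈ S)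
    (h₁ : ∀ᶠ y in 𝓝[S] x, IsHorizontalAt A S F₁ y) (h₂ : ∀ᶠ y in 𝓝[S] x, IsHorizontalAt A S F₂ y)
    (he : ∀ᶠ y in 𝓝[S] x, π (F₁ y) = π (F₂ y)) :
    ∃ c : G, ∀ᶠ y in 𝓝[S] x, F₂ y = F₁ y <• c := by
  have : IsManifold 𝓘(ℝ, EG) 1 G := IsManifold.of_le (n := ∞) (by simp)
  obtain ⟨κ, hκ⟩ := hπ.exists_smooth_eq_act (h₁.mono fun _ h => h.smooth)
    (h₂.mono fun _ h => h.smooth) hx he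
  have hconst : ∀ᶠ y in 𝓝[S] x, κ y = κ x := by
    refine eventually_eq_of_hasMFDerivWithinAt_zero (E := EG) hS hx ?_
    filter_upwards [h₁, h₂, hκ, eventually_eventually_nhdsWithin.2 hκ, self_mem_nhdsWithin]
      with y hy₁ hy₂ hκy hκy' hyS
    have hd := hκy.1.mdifferentiableWithinAt (by simp)
    rw [← hy₁.mfderivWithin_eq_zero_of_eq_act hy₂ hA hπ.smooth_act (hSu y hyS) hd
      (hκy'.mono fun _ h => h.2) hκy.2]
    exact hd.hasMFDerivWithinAt
  exact ⟨κ x, by filter_upwards [hκ, hconst] with y hy hyc using hyc ▸ hy.2⟩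

end HorizontalAt

section LocalExistence

variable {EG : Type*} [NormedAddCommGroup EG] [NormedSpace ℝ EG]
  {G : Type*} [TopologicalSpace G] [ChartedSpace EG G] [Group G]
  {EM : Type*} [NormedAddCommGroup EM] [NormedSpace ℝ EM]
  {M : Type*} [TopologicalSpace M] [ChartedSpace EM M]
  {EP : Type*} [NormedAddCommGroup EP] [NormedSpace ℝ EP]
  {P : Type*} [TopologicalSpace P] [ChartedSpace EP P] [MulAction Gᵐᵒᵖ P]
  {E' : Type*} [NormedAddCommGroup E'] [NormedSpace ℝ E']
  {A : ∀ p : P, TangentSpace 𝓘(ℝ, EP) p →L[ℝ] GroupLieAlgebra 𝓘(ℝ, EG) G} {π : P → M}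
  {S : Set E'} {s : E' → P} {x : E'} {y : EG}

/-- The map `(x, y) ↦ s x · χ⁻¹ y`, with `χ` the chart of `G` at `1`. It turns the search for a
horizontal map `x ↦ s x · χ⁻¹ (g x)` into a total differential equation for `g`. -/
noncomputable def sectionMul (G : Type*) [TopologicalSpace G] [ChartedSpace EG G] [Group G]
    [MulAction Gᵐᵒᵖ P] (s : E' → P) (z : E' × EG) : P :=
  s z.1 <• (extChartAt 𝓘(ℝ, EG) (1 : G)).symm z.2

variable [LieGroup 𝓘(ℝ, EG) ∞ G]

theorem contMDiffWithinAt_sectionMul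
    (hact : ContMDiff (𝓘(ℝ, EP).prod 𝓘(ℝ, EG)) 𝓘(ℝ, EP) ∞ (fun x : P × G => x.1 <• x.2))
    (hs : ContMDiffWithinAt 𝓘(ℝ, E') 𝓘(ℝ, EP) ∞ s S x)
    (hy : y ∈ (extChartAt 𝓘(ℝ, EG) (1 : G)).target) :
    ContMDiffWithinAt 𝓘(ℝ, E' × EG) 𝓘(ℝ, EP) ∞ (sectionMul G s) (S ×ˢ univ) (x, y) := by
  have hfst : ContMDiffWithinAt 𝓘(ℝ, E' × EG) 𝓘(ℝ, EP) ∞ (fun z : E' × EG => s z.1)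
      (S ×ˢ univ) (x, y) :=
    hs.comp (x, y) contDiff_fst.contDiffWithinAt.contMDiffWithinAt fun z hz => hz.1
  have hsnd : ContMDiffWithinAt 𝓘(ℝ, E' × EG) 𝓘(ℝ, EG) ∞
      (fun z : E' × EG => (extChartAt 𝓘(ℝ, EG) (1 : G)).symm z.2) (S ×ˢ univ) (x, y) :=
    ((contMDiffOn_extChartAt_symm (1 : G)).contMDiffAt
      ((isOpen_extChartAt_target 1).mem_nhds hy)).comp_contMDiffWithinAt (x, y)
      contDiff_snd.contDiffWithinAt.contMDiffWithinAt
  exact hact.contMDiffAt.comp_contMDiffWithinAt (x, y) (hfst.prodMk hsnd)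

theorem mfderiv_comp_mfderivWithin_sectionMul (hπ : IsPrincipalBundle EG EM EP G π)
    (hS : UniqueDiffWithinAt ℝ S x) (hs : ContMDiffWithinAt 𝓘(ℝ, E') 𝓘(ℝ, EP) ∞ s S x)
    (hy : y ∈ (extChartAt 𝓘(ℝ, EG) (1 : G)).target) (w : E' × EG) :
    (mfderiv 𝓘(ℝ, EP) 𝓘(ℝ, EM) π (sectionMul G s (x, y)) (mfderivWithin 𝓘(ℝ, E' × EG) 𝓘(ℝ, EP)
      (sectionMul G s) (S ×ˢ univ) (x, y) w) : EM) =
      mfderivWithin 𝓘(ℝ, E') 𝓘(ℝ, EM) (fun x => π (s x)) S x w.1 := by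
  have hD := (hS.prod (uniqueDiffWithinAt_univ (x := y))).uniqueMDiffWithinAt
  have hΨ := (contMDiffWithinAt_sectionMul hπ.smooth_act hs hy).mdifferentiableWithinAt (by simp)
  have hπs : MDifferentiableWithinAt 𝓘(ℝ, E') 𝓘(ℝ, EM) (fun x => π (s x)) S x :=
    (hπ.smooth_proj.contMDiffAt.comp_contMDiffWithinAt x hs).mdifferentiableWithinAt (by simp)
  have hπz := hπ.smooth_proj.mdifferentiable (by simp) (sectionMul G s (x, y))
  have hcomp := hπz.hasMFDerivAt.comp_hasMFDerivWithinAt (x, y) hΨ.hasMFDerivWithinAt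
  have hcomp' := hπs.hasMFDerivWithinAt.comp (x, y) (hasFDerivWithinAt_fst (𝕜 := ℝ)
    (s := S ×ˢ (univ : Set EG))).hasMFDerivWithinAt fun z hz => hz.1
  have hfun : π ∘ sectionMul (EG := EG) G s = (fun x => π (s x)) ∘ Prod.fst :=
    funext fun z => hπ.proj_act _ _
  rw [hfun] at hcomp
  exact congrArg (fun L : E' × EG →L[ℝ] EM => L w) (hD.eq hcomp hcomp')

variable [IsManifold 𝓘(ℝ, EP) ∞ P]

theorem IsConnectionForm.isInvertible_fibrePart_sectionMul (hA : IsConnectionForm A)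
    (hact : ContMDiff (𝓘(ℝ, EP).prod 𝓘(ℝ, EG)) 𝓘(ℝ, EP) ∞ (fun x : P × G => x.1 <• x.2))
    (hS : UniqueDiffWithinAt ℝ S x) (hs : MDifferentiableWithinAt 𝓘(ℝ, E') 𝓘(ℝ, EP) s S x)
    (hy : y ∈ (extChartAt 𝓘(ℝ, EG) (1 : G)).target) :
    (fibrePart (pullbackForm (V := EG) A (S ×ˢ univ) (sectionMul G s)) (x, y)).IsInvertible := by
  have : IsManifold 𝓘(ℝ, EG) 1 G := IsManifold.of_le (n := ∞) (by simp)
  have hD : UniqueDiffWithinAt ℝ (S ×ˢ (univ : Set EG)) (x, y) := hS.prod uniqueDiffWithinAt_univ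
  have hχ : MDifferentiableWithinAt 𝓘(ℝ, EG) 𝓘(ℝ, EG) (extChartAt 𝓘(ℝ, EG) (1 : G)).symm univ y :=
    (mdifferentiableAt_extChartAt_symm hy).mdifferentiableWithinAt
  have hact_form := hA.pullbackForm_act hact hD
    (F := fun z : E' × EG => s z.1) (k := fun z => (extChartAt 𝓘(ℝ, EG) (1 : G)).symm z.2)
    (hs.comp (x, y) differentiableWithinAt_fst.mdifferentiableWithinAt fun z hz => hz.1)
    (hχ.comp (x, y) differentiableWithinAt_snd.mdifferentiableWithinAt fun _ _ => mem_univ _)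
  rw [pullbackForm_comp (f := Prod.fst) hs differentiableWithinAt_fst (fun z hz => hz.1) hD,
    pullbackForm_comp (f := Prod.snd) hχ differentiableWithinAt_snd (fun _ _ => mem_univ _) hD,
    fderivWithin_fst hD, fderivWithin_snd hD] at hact_form
  have hfibre : fibrePart (pullbackForm (V := EG) A (S ×ˢ univ) (sectionMul G s)) (x, y) =
      pullbackForm maurerCartan univ (extChartAt 𝓘(ℝ, EG) (1 : G)).symm y := by
    refine (congrArg (· ∘L ContinuousLinearMap.inr ℝ E' EG) hact_form).trans ?_
    simp only [ContinuousLinearMap.add_comp, ContinuousLinearMap.comp_assoc,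
      ContinuousLinearMap.fst_comp_inr, ContinuousLinearMap.snd_comp_inr,
      ContinuousLinearMap.comp_zero, zero_add, ContinuousLinearMap.comp_id]
  rw [hfibre]
  have hχ' := isInvertible_mfderivWithin_extChartAt_symm hy
  rw [modelWithCornersSelf_coe, range_id] at hχ'
  exact (isInvertible_maurerCartan _).comp hχ'

theorem IsConnectionForm.fderivWithin_pullbackForm_sectionMul_comm (hA : IsConnectionForm A)
    (hπ : IsPrincipalBundle EG EM EP G π) (hS : Convex ℝ S) (hSi : (interior S).Nonempty)
    (hx : x ∈ S) (hs : ContMDiffWithinAt 𝓘(ℝ, E') 𝓘(ℝ, EP) ∞ s S x)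
    (hrank : ∀ ξ ξ' : E', ¬ LinearIndependent ℝ (M := TangentSpace 𝓘(ℝ, EM) (π (s x)))
      ![mfderivWithin 𝓘(ℝ, E') 𝓘(ℝ, EM) (fun x => π (s x)) S x ξ,
        mfderivWithin 𝓘(ℝ, E') 𝓘(ℝ, EM) (fun x => π (s x)) S x ξ'])
    (hy : y ∈ (extChartAt 𝓘(ℝ, EG) (1 : G)).target) {w w' : E' × EG}
    (hw : pullbackForm A (S ×ˢ univ) (sectionMul G s) (x, y) w = 0)
    (hw' : pullbackForm A (S ×ˢ univ) (sectionMul G s) (x, y) w' = 0) :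
    fderivWithin ℝ (pullbackForm (V := EG) A (S ×ˢ univ) (sectionMul G s)) (S ×ˢ univ) (x, y) w w' =
      fderivWithin ℝ (pullbackForm (V := EG) A (S ×ˢ univ) (sectionMul G s)) (S ×ˢ univ) (x, y)
        w' w := by
  have hSu := uniqueDiffOn_convex hS hSi
  have hclosure : (x, y) ∈ closure (interior (S ×ˢ (univ : Set EG))) := by
    rw [interior_prod_eq, closure_prod_eq, interior_univ, closure_univ,
      hS.closure_interior_eq_closure_of_nonempty_interior hSi]
    exact ⟨subset_closure hx, mem_univ y⟩
  refine IsSmoothForm.fderivWithin_pullbackForm_comm (V := EG) hA.smooth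
    (hSu.prod uniqueDiffOn_univ) (mk_mem_prod hx (mem_univ y)) hclosure
    (contMDiffWithinAt_sectionMul hπ.smooth_act hs hy)
    (hA.not_linearIndependent_of_horizontal hπ hw hw' fun h => ?_)
  have hproj := mfderiv_comp_mfderivWithin_sectionMul (y := y) hπ (hSu x hx) hs hy
  exact hrank w.1 w'.1 ((congrArg₂ (fun a b : EM => ![a, b]) (hproj w) (hproj w')).subst
    (motive := fun v => LinearIndependent ℝ v) h)

theorem IsConnectionForm.exists_horizontal_of_section [CompleteSpace EG] (hA : IsConnectionForm A)
    (hπ : IsPrincipalBundle EG EM EP G π) (hS : Convex ℝ S) (hSi : (interior S).Nonempty)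
    (hx : x ∈ S) (hs : ∀ᶠ y in 𝓝[S] x, ContMDiffWithinAt 𝓘(ℝ, E') 𝓘(ℝ, EP) ∞ s S y)
    (hrank : ∀ᶠ y in 𝓝[S] x, ∀ ξ ξ' : E',
      ¬ LinearIndependent ℝ (M := TangentSpace 𝓘(ℝ, EM) (π (s y)))
        ![mfderivWithin 𝓘(ℝ, E') 𝓘(ℝ, EM) (fun x => π (s x)) S y ξ,
          mfderivWithin 𝓘(ℝ, E') 𝓘(ℝ, EM) (fun x => π (s x)) S y ξ']) :
    ∃ F : E' → P, ∀ᶠ y in 𝓝[S] x, IsHorizontalAt A S F y ∧ π (F y) = π (s y) := by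
  set y₀ := extChartAt 𝓘(ℝ, EG) (1 : G) 1
  have hSu := uniqueDiffOn_convex hS hSi
  have hD : UniqueDiffOn ℝ (S ×ˢ (univ : Set EG)) := hSu.prod uniqueDiffOn_univ
  have htarget : ∀ᶠ y in 𝓝 y₀, y ∈ (extChartAt 𝓘(ℝ, EG) (1 : G)).target :=
    (isOpen_extChartAt_target 1).mem_nhds (mem_extChartAt_target 1)
  have hfst : Tendsto Prod.fst (𝓝[S ×ˢ (univ : Set EG)] (x, y₀)) (𝓝[S] x) :=
    continuous_fst.continuousWithinAt.tendsto_nhdsWithin fun z hz => hz.1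
  have hsnd : Tendsto Prod.snd (𝓝[S ×ˢ (univ : Set EG)] (x, y₀)) (𝓝 y₀) :=
    continuous_snd.continuousWithinAt
  have hgood := ((hfst.eventually (hs.and hrank)).and (hsnd.eventually htarget)).and
    self_mem_nhdsWithin
  obtain ⟨g, hg₀, hg⟩ := exists_graph_tangent_ker hS hSi hx
    (θ := pullbackForm (V := EG) A (S ×ˢ univ) (sectionMul G s)) (y₀ := y₀)
    (hgood.mono fun z hz => IsSmoothForm.contDiffWithinAt_pullbackForm (V := EG) hA.smooth hD hz.2
      (contMDiffWithinAt_sectionMul hπ.smooth_act hz.1.1.1 hz.1.2))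
    (hA.isInvertible_fibrePart_sectionMul hπ.smooth_act (hSu x hx)
      ((hs.self_of_nhdsWithin hx).mdifferentiableWithinAt (by simp)) (mem_extChartAt_target 1))
    (hgood.mono fun z hz w w' => hA.fderivWithin_pullbackForm_sectionMul_comm hπ hS hSi hz.2.1
      hz.1.1.1 hz.1.1.2 hz.1.2)
  refine ⟨fun y => sectionMul G s (y, g y), ?_⟩
  have hgx : Tendsto g (𝓝[S] x) (𝓝 y₀) :=
    hg₀ ▸ (hg.self_of_nhdsWithin hx).1.continuousWithinAt
  filter_upwards [hg, hs, hgx.eventually htarget, self_mem_nhdsWithin]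
    with y ⟨hgy, g', hg', hker⟩ hsy hty hyS
  have hΨ := contMDiffWithinAt_sectionMul hπ.smooth_act hsy hty
  have hgraph : MapsTo (fun y => (y, g y)) S (S ×ˢ univ) := fun y hy => ⟨hy, mem_univ _⟩
  refine ⟨⟨hΨ.comp y (contDiffWithinAt_id.prodMk hgy).contMDiffWithinAt hgraph, ?_⟩,
    hπ.proj_act _ _⟩
  have hd : HasFDerivWithinAt (fun y => (y, g y)) (.prod (.id ℝ E') g') S y :=
    (hasFDerivWithinAt_id y S).prodMk hg'
  rw [pullbackForm_comp (f := fun y => (y, g y)) (hΨ.mdifferentiableWithinAt (by simp))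
    hd.differentiableWithinAt hgraph (hSu y hyS), hd.fderivWithin (hSu y hyS)]
  ext ξ
  exact hker ξ

theorem IsConnectionForm.exists_local_lift [CompleteSpace EG] (hA : IsConnectionForm A)
    (hπ : IsPrincipalBundle EG EM EP G π) (hS : Convex ℝ S) (hSi : (interior S).Nonempty)
    {Γ : E' → M} (hΓ : ContMDiffOn 𝓘(ℝ, E') 𝓘(ℝ, EM) ∞ Γ S)
    (hrank : ∀ x ∈ S, ∀ ξ ξ' : E', ¬ LinearIndependent ℝ (M := TangentSpace 𝓘(ℝ, EM) (Γ x))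
      ![mfderivWithin 𝓘(ℝ, E') 𝓘(ℝ, EM) Γ S x ξ, mfderivWithin 𝓘(ℝ, E') 𝓘(ℝ, EM) Γ S x ξ'])
    (hx : x ∈ S) : ∃ F : E' → P, ∀ᶠ y in 𝓝[S] x, IsHorizontalAt A S F y ∧ π (F y) = Γ y := by
  obtain ⟨U, hU, hxU, σ, -, hσ, -, -, hπσ⟩ := hπ.exists_section (Γ x)
  have hΓU : ∀ᶠ y in 𝓝[S] x, Γ y ∈ U :=
    (hΓ x hx).continuousWithinAt.eventually (hU.mem_nhds hxU)
  obtain ⟨F, hF⟩ := hA.exists_horizontal_of_section hπ hS hSi hx (s := fun y => σ (Γ y))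
    (by
      filter_upwards [hΓU, self_mem_nhdsWithin] with y hy hyS
      exact (hσ.contMDiffAt (hU.mem_nhds hy)).comp_contMDiffWithinAt y (hΓ y hyS))
    (by
      filter_upwards [hΓU, eventually_eventually_nhdsWithin.2 hΓU, self_mem_nhdsWithin]
        with y hy hyU hyS ξ ξ'
      have hd : (mfderivWithin 𝓘(ℝ, E') 𝓘(ℝ, EM) (fun y => π (σ (Γ y))) S y : E' →L[ℝ] EM) =
          mfderivWithin 𝓘(ℝ, E') 𝓘(ℝ, EM) Γ S y :=
        Filter.EventuallyEq.mfderivWithin_eq (hyU.mono fun z hz => hπσ _ hz) (hπσ _ hy)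
      exact fun h => hrank y hyS ξ ξ' (hd ▸ h))
  exact ⟨F, by filter_upwards [hF, hΓU] with y hy hyU using ⟨hy.1, hy.2.trans (hπσ _ hyU)⟩⟩

end LocalExistence

theorem exists_of_local_of_glue {a b : ℝ} (hab : a ≤ b) {Q : ℝ → ℝ → Prop}
    (hloc : ∀ m ∈ Icc a b, ∃ p q, p < m ∧ m < q ∧ Q p q)
    (hglue : ∀ m ∈ Icc a b, ∀ p q p' q', p < m → m < q → p' < m → m < q' → Q p q → Q p' q' →
      Q p q') : ∃ p q, p < a ∧ b < q ∧ Q p q := by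
  obtain ⟨p₀, q₀, hp₀, hq₀, hQ₀⟩ := hloc a (left_mem_Icc.2 hab)
  let T : Set ℝ := {m | m ∈ Icc a b ∧ ∃ q, m < q ∧ Q p₀ q}
  have haT : a ∈ T := ⟨left_mem_Icc.2 hab, q₀, hq₀, hQ₀⟩
  have hTb : BddAbove T := ⟨b, fun m hm => hm.1.2⟩
  have ha : a ≤ sSup T := le_csSup hTb haT
  have hb : sSup T ≤ b := csSup_le ⟨a, haT⟩ fun m hm => hm.1.2
  obtain ⟨p, q, hp, hq, hQ⟩ := hloc (sSup T) ⟨ha, hb⟩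
  obtain ⟨m, hm, hpm⟩ := exists_lt_of_lt_csSup ⟨a, haT⟩ hp
  obtain ⟨q', hmq', hQ'⟩ := hm.2
  have hQq : Q p₀ q := hglue m hm.1 p₀ q' p q (hp₀.trans_le hm.1.1) hmq' hpm
    ((le_csSup hTb hm).trans_lt hq) hQ' hQ
  refine ⟨p₀, q, hp₀, ?_, hQq⟩
  by_contra! hqb
  obtain ⟨c, hc, hcq⟩ := exists_between hq
  exact (le_csSup hTb ⟨⟨ha.trans hc.le, hcq.le.trans hqb⟩, q, hcq, hQq⟩).not_gt hc

section GlobalExistence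

variable {EG : Type*} [NormedAddCommGroup EG] [NormedSpace ℝ EG]
  {G : Type*} [TopologicalSpace G] [ChartedSpace EG G] [Group G]
  {M : Type*}
  {EP : Type*} [NormedAddCommGroup EP] [NormedSpace ℝ EP]
  {P : Type*} [TopologicalSpace P] [ChartedSpace EP P]
  {E' : Type*} [NormedAddCommGroup E'] [NormedSpace ℝ E']

/-- `F` is a totally horizontal lift of `Γ : S → M` along `π`. For `S` an interval this is a
horizontal lift of a path; on a set with interior it can only exist if the pulled back connection
is flat. -/
def IsHorizontalLiftOn
    (A : ∀ p : P, TangentSpace 𝓘(ℝ, EP) p →L[ℝ] GroupLieAlgebra 𝓘(ℝ, EG) G) (π : P → M)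
    (S : Set E') (Γ : E' → M) (F : E' → P) : Prop :=
  ∀ x ∈ S, IsHorizontalAt A S F x ∧ π (F x) = Γ x

variable {A : ∀ p : P, TangentSpace 𝓘(ℝ, EP) p →L[ℝ] GroupLieAlgebra 𝓘(ℝ, EG) G} {π : P → M}
  {S W W₁ W₂ : Set E'} {Γ : E' → M} {F F₁ F₂ : E' → P} {x : E'}

theorem isHorizontalLiftOn_inter_iff (hW : IsOpen W) :
    IsHorizontalLiftOn A π (S ∩ W) Γ F ↔ ∀ x ∈ S ∩ W, IsHorizontalAt A S F x ∧ π (F x) = Γ x :=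
  forall₂_congr fun _ hx => and_congr_left' (isHorizontalAt_inter_iff (hW.mem_nhds hx.2))

theorem IsHorizontalLiftOn.inter (h : IsHorizontalLiftOn A π S Γ F) (hW : IsOpen W) :
    IsHorizontalLiftOn A π (S ∩ W) Γ F :=
  (isHorizontalLiftOn_inter_iff hW).2 fun x hx => h x hx.1

theorem IsHorizontalLiftOn.contMDiffOn (h : IsHorizontalLiftOn A π S Γ F) :
    ContMDiffOn 𝓘(ℝ, E') 𝓘(ℝ, EP) ∞ F S := fun x hx => (h x hx).1.smooth

variable {EM : Type*} [NormedAddCommGroup EM] [NormedSpace ℝ EM]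
  [TopologicalSpace M] [ChartedSpace EM M] [MulAction Gᵐᵒᵖ P]

theorem IsPrincipalBundle.exists_eq_act (hπ : IsPrincipalBundle EG EM EP G π) {p q : P}
    (h : π p = π q) : ∃ c : G, q = p <• c := by
  obtain ⟨U, -, hpU, σ, k, -, -, hσk, -⟩ := hπ.exists_section (π p)
  have hq : σ (π q) <• k q = q := hσk q (by rwa [mem_preimage, ← h])
  refine ⟨(k p)⁻¹ * k q, ?_⟩
  calc q = σ (π p) <• k q := by rw [h, hq]
    _ = (σ (π p) <• k p) <• ((k p)⁻¹ * k q) := by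
      simp only [smul_smul, ← MulOpposite.op_mul, mul_inv_cancel_left]
    _ = p <• ((k p)⁻¹ * k q) := by rw [hσk p hpU]

variable [IsManifold 𝓘(ℝ, EP) ∞ P] [LieGroup 𝓘(ℝ, EG) ∞ G]

theorem IsHorizontalLiftOn.act (h : IsHorizontalLiftOn A π S Γ F) (hA : IsConnectionForm A)
    (hπ : IsPrincipalBundle EG EM EP G π) (hS : UniqueDiffOn ℝ S) (c : G) :
    IsHorizontalLiftOn A π S Γ (fun x => F x <• c) := fun x hx =>
  ⟨(h x hx).1.act hA hπ.smooth_act (hS x hx) c, (hπ.proj_act _ _).trans (h x hx).2⟩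

theorem IsHorizontalLiftOn.eqOn (h₁ : IsHorizontalLiftOn A π S Γ F₁)
    (h₂ : IsHorizontalLiftOn A π S Γ F₂) (hA : IsConnectionForm A)
    (hπ : IsPrincipalBundle EG EM EP G π) (hS : Convex ℝ S) (hSu : UniqueDiffOn ℝ S) (hx : x ∈ S)
    (he : F₁ x = F₂ x) : EqOn F₁ F₂ S := by
  intro y hy
  refine (hS.isPreconnected.induction₂ (fun x y => F₁ x = F₂ x ↔ F₁ y = F₂ y)
    (fun z hz => ?_) (fun _ _ _ _ _ _ => Iff.trans) (fun _ _ _ _ => Iff.symm) hx hy).1 he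
  obtain ⟨c, hc⟩ := IsHorizontalAt.exists_eventually_eq_act hA hπ hS hSu hz
    (eventually_mem_nhdsWithin.mono fun y hy => (h₁ y hy).1)
    (eventually_mem_nhdsWithin.mono fun y hy => (h₂ y hy).1)
    (eventually_mem_nhdsWithin.mono fun y hy => (h₁ y hy).2.trans (h₂ y hy).2.symm)
  have hiff : ∀ y, F₂ y = F₁ y <• c → (F₁ y = F₂ y ↔ c = 1) := by
    intro y hy
    refine ⟨fun h => hπ.free (F₁ y) c (hy.symm.trans h.symm), fun h => ?_⟩
    rw [hy, h, MulOpposite.op_one, one_smul]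
  filter_upwards [hc] with y hy
  rw [hiff z (hc.self_of_nhdsWithin hz), hiff y hy]

theorem IsHorizontalLiftOn.exists_of_union (hA : IsConnectionForm A)
    (hπ : IsPrincipalBundle EG EM EP G π) (hS : Convex ℝ S) (hSu : UniqueDiffOn ℝ S)
    (hW₁ : IsOpen W₁) (hW₁c : Convex ℝ W₁) (hW₂ : IsOpen W₂) (hW₂c : Convex ℝ W₂)
    (hSW : S ⊆ W₁ ∪ W₂) (hx : x ∈ S ∩ (W₁ ∩ W₂)) (h₁ : IsHorizontalLiftOn A π (S ∩ W₁) Γ F₁)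
    (h₂ : IsHorizontalLiftOn A π (S ∩ W₂) Γ F₂) : ∃ F, IsHorizontalLiftOn A π S Γ F := by
  classical
  obtain ⟨c, hc⟩ := hπ.exists_eq_act (p := F₂ x) (q := F₁ x)
    ((h₂ x ⟨hx.1, hx.2.2⟩).2.trans (h₁ x ⟨hx.1, hx.2.1⟩).2.symm)
  have h₂c := h₂.act hA hπ (hSu.inter hW₂) c
  have heq : EqOn F₁ (fun y => F₂ y <• c) (S ∩ (W₁ ∩ W₂)) := by
    have h₁' := h₁.inter hW₂
    have h₂' := h₂c.inter hW₁
    rw [inter_assoc] at h₁' h₂'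
    rw [inter_comm W₂] at h₂'
    exact h₁'.eqOn h₂' hA hπ (hS.inter (hW₁c.inter hW₂c)) (hSu.inter (hW₁.inter hW₂)) hx hc
  have heq₁ : EqOn (W₁.piecewise F₁ fun y => F₂ y <• c) F₁ W₁ := piecewise_eqOn _ _ _
  have heq₂ : EqOn (W₁.piecewise F₁ fun y => F₂ y <• c) (fun y => F₂ y <• c) (S ∩ W₂) := by
    intro y hy
    by_cases hyW : y ∈ W₁
    · exact (heq₁ hyW).trans (heq ⟨hy.1, hyW, hy.2⟩)
    · exact piecewise_eq_of_notMem _ _ _ hyW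
  rw [isHorizontalLiftOn_inter_iff hW₁] at h₁
  rw [isHorizontalLiftOn_inter_iff hW₂] at h₂c
  refine ⟨W₁.piecewise F₁ fun y => F₂ y <• c, fun y hy => ?_⟩
  rcases hSW hy with hyW | hyW
  · have he : W₁.piecewise F₁ (fun y => F₂ y <• c) =ᶠ[𝓝[S] y] F₁ :=
      heq₁.eventuallyEq_of_mem (mem_nhdsWithin_of_mem_nhds (hW₁.mem_nhds hyW))
    exact ⟨(h₁ y ⟨hy, hyW⟩).1.congr he (heq₁ hyW),
      (congrArg π (heq₁ hyW)).trans (h₁ y ⟨hy, hyW⟩).2⟩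
  · have he := heq₂.eventuallyEq_of_mem (inter_mem_nhdsWithin S (hW₂.mem_nhds hyW))
    exact ⟨(h₂c y ⟨hy, hyW⟩).1.congr he (heq₂ ⟨hy, hyW⟩),
      (congrArg π (heq₂ ⟨hy, hyW⟩)).trans (h₂c y ⟨hy, hyW⟩).2⟩

theorem IsHorizontalLiftOn.exists_of_strips (hA : IsConnectionForm A)
    (hπ : IsPrincipalBundle EG EM EP G π) (hS : Convex ℝ S) (hSu : UniqueDiffOn ℝ S)
    (l : E' →L[ℝ] ℝ) {a b : ℝ} (hab : a ≤ b) (hl : l '' S = Icc a b)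
    (hloc : ∀ m ∈ Icc a b, ∃ δ > 0, ∃ F, IsHorizontalLiftOn A π (S ∩ l ⁻¹' ball m δ) Γ F) :
    ∃ F, IsHorizontalLiftOn A π S Γ F := by
  have hopen : ∀ p q, IsOpen (l ⁻¹' Ioo p q) := fun p q => isOpen_Ioo.preimage l.continuous
  have hconv : ∀ p q, Convex ℝ (l ⁻¹' Ioo p q) := fun p q =>
    (convex_Ioo p q).linear_preimage l.toLinearMap
  obtain ⟨p, q, hpa, hbq, F, hF⟩ := exists_of_local_of_glue hab
    (Q := fun p q => ∃ F, IsHorizontalLiftOn A π (S ∩ l ⁻¹' Ioo p q) Γ F)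
    (fun m hm => by
      obtain ⟨δ, hδ, hF⟩ := hloc m hm
      exact ⟨m - δ, m + δ, sub_lt_self m hδ, lt_add_of_pos_right m hδ, Real.ball_eq_Ioo m δ ▸ hF⟩)
    (by
      rintro m hm p q p' q' hpm hmq hpm' hmq' ⟨F₁, h₁⟩ ⟨F₂, h₂⟩
      obtain ⟨x, hx, rfl⟩ := hl.ge hm
      have h₁' := h₁.inter (hopen p q')
      have h₂' := h₂.inter (hopen p q')
      rw [inter_right_comm] at h₁' h₂'
      refine IsHorizontalLiftOn.exists_of_union hA hπ (hS.inter (hconv p q'))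
        (hSu.inter (hopen p q')) (hopen p q) (hconv p q) (hopen p' q') (hconv p' q')
        (fun y hy => ?_) (x := x) ⟨⟨hx, hpm, hmq'⟩, ⟨hpm, hmq⟩, hpm', hmq'⟩ h₁' h₂'
      rcases le_or_gt (l y) (l x) with hle | hlt
      exacts [.inl ⟨hy.2.1, hle.trans_lt hmq⟩, .inr ⟨hpm'.trans hlt, hy.2.2⟩])
  refine ⟨F, ?_⟩
  rwa [inter_eq_left.2 fun x hx => ?_] at hF
  have hlx : l x ∈ Icc a b := hl.le (mem_image_of_mem l hx)
  exact ⟨hpa.trans_le hlx.1, hlx.2.trans_lt hbq⟩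

theorem IsHorizontalLiftOn.exists_of_rectangle (hA : IsConnectionForm A)
    (hπ : IsPrincipalBundle EG EM EP G π) {s₀ s₁ t₀ t₁ : ℝ} (hs : s₀ < s₁) (ht : t₀ < t₁)
    {Γ : ℝ × ℝ → M} (hloc : ∀ z ∈ Icc s₀ s₁ ×ˢ Icc t₀ t₁, ∃ ε > 0, ∃ F,
      IsHorizontalLiftOn A π (Icc s₀ s₁ ×ˢ Icc t₀ t₁ ∩ ball z ε) Γ F) :
    ∃ F, IsHorizontalLiftOn A π (Icc s₀ s₁ ×ˢ Icc t₀ t₁) Γ F := by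
  have hconv : Convex ℝ (Icc s₀ s₁ ×ˢ Icc t₀ t₁) := (convex_Icc s₀ s₁).prod (convex_Icc t₀ t₁)
  have hunique : UniqueDiffOn ℝ (Icc s₀ s₁ ×ˢ Icc t₀ t₁) :=
    (uniqueDiffOn_Icc hs).prod (uniqueDiffOn_Icc ht)
  obtain ⟨δ, hδ, hlift⟩ : ∃ δ > 0, ∀ z ∈ Icc s₀ s₁ ×ˢ Icc t₀ t₁, ∃ F,
      IsHorizontalLiftOn A π (Icc s₀ s₁ ×ˢ Icc t₀ t₁ ∩ ball z δ) Γ F := by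
    choose ε hε F hF using hloc
    obtain ⟨δ, hδ, hball⟩ := lebesgue_number_lemma_of_metric
      (c := fun z : Icc s₀ s₁ ×ˢ Icc t₀ t₁ => ball (z : ℝ × ℝ) (ε z z.2))
      (isCompact_Icc.prod isCompact_Icc) (fun _ => isOpen_ball)
      fun z hz => mem_iUnion.2 ⟨⟨z, hz⟩, mem_ball_self (hε z hz)⟩
    refine ⟨δ, hδ, fun z hz => ?_⟩
    obtain ⟨w, hw⟩ := hball z hz
    have h := (hF w w.2).inter (isOpen_ball (x := z) (ε := δ))
    rw [inter_assoc, inter_eq_right.2 hw] at h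
    exact ⟨F w w.2, h⟩
  refine exists_of_strips hA hπ hconv hunique (.fst ℝ ℝ ℝ) hs.le
    (fst_image_prod _ (nonempty_Icc.2 ht.le)) fun u hu => ⟨δ, hδ, ?_⟩
  have hopen : IsOpen (ContinuousLinearMap.fst ℝ ℝ ℝ ⁻¹' ball u δ) :=
    isOpen_ball.preimage continuous_fst
  refine exists_of_strips hA hπ (hconv.inter ((convex_ball u δ).linear_preimage
    (LinearMap.fst ℝ ℝ ℝ))) (hunique.inter hopen) (.snd ℝ ℝ ℝ) ht.le ?_ fun t ht => ⟨δ, hδ, ?_⟩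
  · refine Subset.antisymm (image_subset_iff.2 fun z hz => hz.1.2) fun t ht =>
      ⟨(u, t), ⟨⟨hu, ht⟩, mem_ball_self hδ⟩, rfl⟩
  · have hball : ContinuousLinearMap.fst ℝ ℝ ℝ ⁻¹' ball u δ ∩
        ContinuousLinearMap.snd ℝ ℝ ℝ ⁻¹' ball t δ = ball (u, t) δ := by
      rw [← ball_prod_same]; rfl
    rw [inter_assoc, hball]
    exact hlift (u, t) ⟨hu, ht⟩

theorem IsConnectionForm.exists_horizontalLiftOn_rectangle [CompleteSpace EG]
    (hA : IsConnectionForm A) (hπ : IsPrincipalBundle EG EM EP G π) {s₀ s₁ t₀ t₁ : ℝ}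
    (hs : s₀ < s₁) (ht : t₀ < t₁) {Γ : ℝ × ℝ → M}
    (hΓ : ContMDiffOn 𝓘(ℝ, ℝ × ℝ) 𝓘(ℝ, EM) ∞ Γ (Icc s₀ s₁ ×ˢ Icc t₀ t₁))
    (hrank : ∀ z ∈ Icc s₀ s₁ ×ˢ Icc t₀ t₁, ∀ ξ ξ' : ℝ × ℝ,
      ¬ LinearIndependent ℝ (M := TangentSpace 𝓘(ℝ, EM) (Γ z))
        ![mfderivWithin 𝓘(ℝ, ℝ × ℝ) 𝓘(ℝ, EM) Γ (Icc s₀ s₁ ×ˢ Icc t₀ t₁) z ξ,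
          mfderivWithin 𝓘(ℝ, ℝ × ℝ) 𝓘(ℝ, EM) Γ (Icc s₀ s₁ ×ˢ Icc t₀ t₁) z ξ'])
    {z : ℝ × ℝ} (hz : z ∈ Icc s₀ s₁ ×ˢ Icc t₀ t₁) {p : P} (hp : π p = Γ z) :
    ∃ F, IsHorizontalLiftOn A π (Icc s₀ s₁ ×ˢ Icc t₀ t₁) Γ F ∧ F z = p := by
  have hinterior : (interior (Icc s₀ s₁ ×ˢ Icc t₀ t₁)).Nonempty := by
    rw [interior_prod_eq, interior_Icc, interior_Icc]
    exact (nonempty_Ioo.2 hs).prod (nonempty_Ioo.2 ht)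
  obtain ⟨F, hF⟩ := IsHorizontalLiftOn.exists_of_rectangle hA hπ hs ht (Γ := Γ) fun w hw => by
    obtain ⟨F, hF⟩ := hA.exists_local_lift hπ ((convex_Icc s₀ s₁).prod (convex_Icc t₀ t₁))
      hinterior hΓ hrank hw
    obtain ⟨ε, hε, hball⟩ := Metric.mem_nhdsWithin_iff.1 hF
    exact ⟨ε, hε, F, (isHorizontalLiftOn_inter_iff isOpen_ball).2 fun x hx => hball hx.symm⟩
  obtain ⟨c, hc⟩ := hπ.exists_eq_act ((hF z hz).2.trans hp.symm)
  exact ⟨fun x => F x <• c,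
    hF.act hA hπ ((uniqueDiffOn_Icc hs).prod (uniqueDiffOn_Icc ht)) c, hc.symm⟩

end GlobalExistence

section Velocity

variable {E : Type*} [NormedAddCommGroup E] [NormedSpace ℝ E]
  {X : Type*} [TopologicalSpace X] [ChartedSpace E X]

theorem velocity_comp {E' : Type*} [NormedAddCommGroup E'] [NormedSpace ℝ E'] {S : Set E'}
    {f : E' → X} {c : ℝ → E'} {c' : E'} {a b t : ℝ} (hab : a < b) (ht : t ∈ Icc a b)
    (hf : MDifferentiableWithinAt 𝓘(ℝ, E') 𝓘(ℝ, E) f S (c t))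
    (hc : HasDerivWithinAt c c' (Icc a b) t) (hcS : MapsTo c (Icc a b) S) :
    velocity E a b (fun r => f (c r)) t = mfderivWithin 𝓘(ℝ, E') 𝓘(ℝ, E) f S (c t) c' := by
  have hcomp := hf.hasMFDerivWithinAt.comp t (f := c) (u := S)
    hc.hasFDerivWithinAt.hasMFDerivWithinAt hcS
  refine (congrArg (fun L : ℝ →L[ℝ] E => L 1)
    (hcomp.mfderivWithin ((uniqueDiffOn_Icc hab).uniqueMDiffOn t ht))).trans ?_
  exact congrArg (mfderivWithin 𝓘(ℝ, E') 𝓘(ℝ, E) f S (c t)) (one_smul ℝ c')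

theorem velocity_congr {a b t : ℝ} {γ c : ℝ → X} (h : EqOn γ c (Icc a b)) (ht : t ∈ Icc a b) :
    (velocity E a b γ t : E) = velocity E a b c t :=
  congrArg (fun L : ℝ →L[ℝ] E => L 1) (mfderivWithin_congr h (h ht))

theorem mfderiv_velocity {EM : Type*} [NormedAddCommGroup EM] [NormedSpace ℝ EM] {M : Type*}
    [TopologicalSpace M] [ChartedSpace EM M] {π : X → M} {a b t : ℝ} {γ : ℝ → X} {c : ℝ → M}
    (hπ : MDifferentiableAt 𝓘(ℝ, E) 𝓘(ℝ, EM) π (γ t)) (hab : a < b) (ht : t ∈ Icc a b)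
    (hγ : MDifferentiableWithinAt 𝓘(ℝ, ℝ) 𝓘(ℝ, E) γ (Icc a b) t)
    (hc : EqOn (π ∘ γ) c (Icc a b)) :
    (mfderiv 𝓘(ℝ, E) 𝓘(ℝ, EM) π (γ t) (velocity E a b γ t) : EM) = velocity EM a b c t := by
  rw [← velocity_congr (E := EM) hc ht]
  refine (congrArg (fun L : ℝ →L[ℝ] EM => L 1) ((hπ.hasMFDerivAt.comp_hasMFDerivWithinAt t
    hγ.hasMFDerivWithinAt).mfderivWithin ((uniqueDiffOn_Icc hab).uniqueMDiffOn t ht))).symm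

variable {s₀ s₁ t₀ t₁ : ℝ} {f : ℝ × ℝ → X}

theorem IsThin.not_linearIndependent_mfderivWithin (hf : IsThin E s₀ s₁ t₀ t₁ f) (hs : s₀ < s₁)
    (ht : t₀ < t₁) {z : ℝ × ℝ} (hz : z ∈ Icc s₀ s₁ ×ˢ Icc t₀ t₁)
    (hfz : MDifferentiableWithinAt 𝓘(ℝ, ℝ × ℝ) 𝓘(ℝ, E) f (Icc s₀ s₁ ×ˢ Icc t₀ t₁) z)
    (ξ ξ' : ℝ × ℝ) :
    ¬ LinearIndependent ℝ (M := TangentSpace 𝓘(ℝ, E) (f z))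
      ![mfderivWithin 𝓘(ℝ, ℝ × ℝ) 𝓘(ℝ, E) f (Icc s₀ s₁ ×ˢ Icc t₀ t₁) z ξ,
        mfderivWithin 𝓘(ℝ, ℝ × ℝ) 𝓘(ℝ, E) f (Icc s₀ s₁ ×ˢ Icc t₀ t₁) z ξ'] := by
  have hleft := velocity_comp (c := fun s => (s, z.2)) hs hz.1 hfz
    ((hasDerivWithinAt_id z.1 _).prodMk (hasDerivWithinAt_const z.1 _ z.2)) fun s hs => ⟨hs, hz.2⟩
  have hright := velocity_comp (c := fun t => (z.1, t)) ht hz.2 hfz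
    ((hasDerivWithinAt_const z.2 _ z.1).prodMk (hasDerivWithinAt_id z.2 _)) fun t ht => ⟨hz.1, ht⟩
  have hdep := hf z.1 hz.1 z.2 hz.2
  rw [hleft, hright] at hdep
  exact not_linearIndependent_map_prod (U := E) (L := (mfderivWithin 𝓘(ℝ, ℝ × ℝ) 𝓘(ℝ, E) f
    (Icc s₀ s₁ ×ˢ Icc t₀ t₁) z : ℝ × ℝ →L[ℝ] E).toLinearMap) hdep ξ ξ'

theorem contMDiffOn_left (hf : ContMDiffOn 𝓘(ℝ, ℝ × ℝ) 𝓘(ℝ, E) ∞ f (Icc s₀ s₁ ×ˢ Icc t₀ t₁))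
    {t : ℝ} (ht : t ∈ Icc t₀ t₁) :
    ContMDiffOn 𝓘(ℝ, ℝ) 𝓘(ℝ, E) ∞ (fun s => f (s, t)) (Icc s₀ s₁) :=
  hf.comp (contDiff_id.prodMk contDiff_const).contMDiff.contMDiffOn fun _ hs => ⟨hs, ht⟩

theorem contMDiffOn_right (hf : ContMDiffOn 𝓘(ℝ, ℝ × ℝ) 𝓘(ℝ, E) ∞ f (Icc s₀ s₁ ×ˢ Icc t₀ t₁))
    {s : ℝ} (hs : s ∈ Icc s₀ s₁) :
    ContMDiffOn 𝓘(ℝ, ℝ) 𝓘(ℝ, E) ∞ (fun t => f (s, t)) (Icc t₀ t₁) :=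
  hf.comp (contDiff_const.prodMk contDiff_id).contMDiff.contMDiffOn fun _ ht => ⟨hs, ht⟩

theorem IsThin.not_linearIndependent_mfderiv_velocity {EM : Type*} [NormedAddCommGroup EM]
    [NormedSpace ℝ EM] {M : Type*} [TopologicalSpace M] [ChartedSpace EM M] {π : X → M}
    {Γ : ℝ × ℝ → M} (hthin : IsThin EM s₀ s₁ t₀ t₁ Γ) (hπ : ContMDiff 𝓘(ℝ, E) 𝓘(ℝ, EM) ∞ π)
    (hs : s₀ < s₁) (ht : t₀ < t₁)
    (hf : ContMDiffOn 𝓘(ℝ, ℝ × ℝ) 𝓘(ℝ, E) ∞ f (Icc s₀ s₁ ×ˢ Icc t₀ t₁))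
    (hfΓ : EqOn (π ∘ f) Γ (Icc s₀ s₁ ×ˢ Icc t₀ t₁)) {u v : ℝ} (hu : u ∈ Icc s₀ s₁)
    (hv : v ∈ Icc t₀ t₁) :
    ¬ LinearIndependent ℝ (M := TangentSpace 𝓘(ℝ, EM) (π (f (u, v))))
      ![mfderiv 𝓘(ℝ, E) 𝓘(ℝ, EM) π (f (u, v)) (velocity E s₀ s₁ (fun s => f (s, v)) u),
        mfderiv 𝓘(ℝ, E) 𝓘(ℝ, EM) π (f (u, v)) (velocity E t₀ t₁ (fun t => f (u, t)) v)] := by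
  have hπd := hπ.mdifferentiable (by simp) (f (u, v))
  have hleft := mfderiv_velocity (c := fun s => Γ (s, v)) hπd hs hu
    ((contMDiffOn_left hf hv u hu).mdifferentiableWithinAt (by simp)) fun s hs => hfΓ ⟨hs, hv⟩
  have hright := mfderiv_velocity (c := fun t => Γ (u, t)) hπd ht hv
    ((contMDiffOn_right hf hu v hv).mdifferentiableWithinAt (by simp)) fun t ht => hfΓ ⟨hu, ht⟩
  exact fun h => hthin u hu v hv ((congrArg₂ (fun a b : EM => ![a, b]) hleft hright).subst
    (motive := fun x => LinearIndependent ℝ x) h)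

end Velocity

section HorizontalPaths

variable {EG : Type*} [NormedAddCommGroup EG] [NormedSpace ℝ EG]
  {G : Type*} [TopologicalSpace G] [ChartedSpace EG G] [Group G]
  {M : Type*}
  {EP : Type*} [NormedAddCommGroup EP] [NormedSpace ℝ EP]
  {P : Type*} [TopologicalSpace P] [ChartedSpace EP P]
  {A : ∀ p : P, TangentSpace 𝓘(ℝ, EP) p →L[ℝ] GroupLieAlgebra 𝓘(ℝ, EG) G} {π : P → M}
  {s₀ s₁ t₀ t₁ : ℝ} {c : ℝ → M} {γ γ₁ γ₂ : ℝ → P}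

theorem isHorizontalPath_iff :
    IsHorizontalPath A t₀ t₁ γ ↔ ∀ t ∈ Icc t₀ t₁, IsHorizontalAt A (Icc t₀ t₁) γ t :=
  ⟨fun h t ht => ⟨h.1 t ht, ContinuousLinearMap.ext_ring (h.2 t ht)⟩,
    fun h => ⟨fun t ht => (h t ht).smooth,
      fun t ht => congrArg (fun L : ℝ →L[ℝ] EG => L 1) (h t ht).pullbackForm_eq_zero⟩⟩

theorem isHorizontalLift_iff :
    IsHorizontalLift π A t₀ t₁ c γ ↔ IsHorizontalLiftOn A π (Icc t₀ t₁) c γ := by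
  rw [IsHorizontalLift, isHorizontalPath_iff, ← forall₂_and]
  rfl

theorem IsHorizontalLiftOn.comp {E' E₁ : Type*} [NormedAddCommGroup E'] [NormedSpace ℝ E']
    [NormedAddCommGroup E₁] [NormedSpace ℝ E₁] {S : Set E'} {T : Set E₁} {Γ : E' → M} {F : E' → P}
    (h : IsHorizontalLiftOn A π S Γ F) {f : E₁ → E'} (hf : ContDiffOn ℝ ∞ f T)
    (hfT : MapsTo f T S) (hT : UniqueDiffOn ℝ T) :
    IsHorizontalLiftOn A π T (fun y => Γ (f y)) (fun y => F (f y)) := fun y hy =>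
  ⟨(h (f y) (hfT hy)).1.comp (hf y hy) hfT (hT y hy), (h (f y) (hfT hy)).2⟩

variable {Γ : ℝ × ℝ → M} {F : ℝ × ℝ → P}

theorem IsHorizontalLiftOn.left (h : IsHorizontalLiftOn A π (Icc s₀ s₁ ×ˢ Icc t₀ t₁) Γ F)
    (hs : s₀ < s₁) {t : ℝ} (ht : t ∈ Icc t₀ t₁) :
    IsHorizontalLift π A s₀ s₁ (fun s => Γ (s, t)) (fun s => F (s, t)) :=
  isHorizontalLift_iff.2 (h.comp (contDiff_id.prodMk contDiff_const).contDiffOn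
    (fun _ hs => mk_mem_prod hs ht) (uniqueDiffOn_Icc hs))

theorem IsHorizontalLiftOn.right (h : IsHorizontalLiftOn A π (Icc s₀ s₁ ×ˢ Icc t₀ t₁) Γ F)
    (ht : t₀ < t₁) {s : ℝ} (hs : s ∈ Icc s₀ s₁) :
    IsHorizontalLift π A t₀ t₁ (fun t => Γ (s, t)) (fun t => F (s, t)) :=
  isHorizontalLift_iff.2 (h.comp (contDiff_const.prodMk contDiff_id).contDiffOn
    (fun _ ht => mk_mem_prod hs ht) (uniqueDiffOn_Icc ht))

variable {EM : Type*} [NormedAddCommGroup EM] [NormedSpace ℝ EM]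
  [TopologicalSpace M] [ChartedSpace EM M] [MulAction Gᵐᵒᵖ P]
  [IsManifold 𝓘(ℝ, EP) ∞ P] [LieGroup 𝓘(ℝ, EG) ∞ G]

theorem IsHorizontalLift.eqOn (h₁ : IsHorizontalLift π A t₀ t₁ c γ₁)
    (h₂ : IsHorizontalLift π A t₀ t₁ c γ₂) (hA : IsConnectionForm A)
    (hπ : IsPrincipalBundle EG EM EP G π) (ht : t₀ < t₁) (h : γ₁ t₀ = γ₂ t₀) :
    EqOn γ₁ γ₂ (Icc t₀ t₁) :=
  (isHorizontalLift_iff.1 h₁).eqOn (isHorizontalLift_iff.1 h₂) hA hπ (convex_Icc t₀ t₁)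
    (uniqueDiffOn_Icc ht) (left_mem_Icc.2 ht.le) h

theorem IsHorizontalLift.eq_of_const (h : IsHorizontalLift π A t₀ t₁ c γ)
    (hA : IsConnectionForm A) (hπ : IsPrincipalBundle EG EM EP G π) (ht : t₀ < t₁)
    (hc : ∀ t ∈ Icc t₀ t₁, c t = c t₀) {t : ℝ} (htt : t ∈ Icc t₀ t₁) : γ t = γ t₀ := by
  have hconst : IsHorizontalLift π A t₀ t₁ c fun _ => γ t₀ :=
    ⟨isHorizontalPath_iff.2 fun _ _ => isHorizontalAt_const _,
      fun t ht' => (h.2 t₀ (left_mem_Icc.2 ht.le)).trans (hc t ht').symm⟩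
  exact h.eqOn hconst hA hπ ht rfl htt

theorem IsThin.exists_horizontalLiftOn [CompleteSpace EG] (hthin : IsThin EM s₀ s₁ t₀ t₁ Γ)
    (hΓ : ContMDiffOn 𝓘(ℝ, ℝ × ℝ) 𝓘(ℝ, EM) ∞ Γ (Icc s₀ s₁ ×ˢ Icc t₀ t₁))
    (hA : IsConnectionForm A) (hπ : IsPrincipalBundle EG EM EP G π) (hs : s₀ < s₁) (ht : t₀ < t₁)
    {p : P} (hp : π p = Γ (s₀, t₀)) :
    ∃ F, IsHorizontalLiftOn A π (Icc s₀ s₁ ×ˢ Icc t₀ t₁) Γ F ∧ F (s₀, t₀) = p :=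
  hA.exists_horizontalLiftOn_rectangle hπ hs ht hΓ
    (fun z hz => hthin.not_linearIndependent_mfderivWithin hs ht hz
      ((hΓ z hz).mdifferentiableWithinAt (by simp)))
    ⟨left_mem_Icc.2 hs.le, left_mem_Icc.2 ht.le⟩ hp

end HorizontalPaths

section OmegaHorizontal

variable {EG : Type*} [NormedAddCommGroup EG] [NormedSpace ℝ EG]
  {G : Type*} [TopologicalSpace G] [ChartedSpace EG G] [Group G]
  {EH : Type*} [NormedAddCommGroup EH] [NormedSpace ℝ EH]
  {H : Type*} [TopologicalSpace H] [ChartedSpace EH H] [Group H]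
  {EM : Type*} [NormedAddCommGroup EM] [NormedSpace ℝ EM]
  {M : Type*} [TopologicalSpace M] [ChartedSpace EM M]
  {EP : Type*} [NormedAddCommGroup EP] [NormedSpace ℝ EP]
  {P : Type*} [TopologicalSpace P] [ChartedSpace EP P]
  {A Abar : ∀ p : P, TangentSpace 𝓘(ℝ, EP) p →L[ℝ] GroupLieAlgebra 𝓘(ℝ, EG) G}
  {B : ∀ p : P, TangentSpace 𝓘(ℝ, EP) p →L[ℝ] TangentSpace 𝓘(ℝ, EP) p →L[ℝ]
    GroupLieAlgebra 𝓘(ℝ, EH) H}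
  {τ : H →* G} {π : P → M} {s₀ s₁ t₀ t₁ : ℝ} {Γ : ℝ × ℝ → M} {F F₁ F₂ : ℝ × ℝ → P}

/-- `B` is a horizontal 2-form on `P`: alternating, and zero when one argument is vertical. -/
structure IsHorizontalTwoForm (EM : Type*) [NormedAddCommGroup EM] [NormedSpace ℝ EM]
    {M : Type*} [TopologicalSpace M] [ChartedSpace EM M] (π : P → M)
    (B : ∀ p : P, TangentSpace 𝓘(ℝ, EP) p →L[ℝ] TangentSpace 𝓘(ℝ, EP) p →L[ℝ]
      GroupLieAlgebra 𝓘(ℝ, EH) H) : Prop where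
  alternating : ∀ (p : P) (v : TangentSpace 𝓘(ℝ, EP) p), B p v v = 0
  vertical : ∀ (p : P) (v w : TangentSpace 𝓘(ℝ, EP) p),
    mfderiv 𝓘(ℝ, EP) 𝓘(ℝ, EM) π p v = 0 → B p v w = 0

theorem IsThin.twoForm_velocity_eq_zero (hthin : IsThin EM s₀ s₁ t₀ t₁ Γ)
    (hB : IsHorizontalTwoForm EM π B)
    (hπ : ContMDiff 𝓘(ℝ, EP) 𝓘(ℝ, EM) ∞ π) (hs : s₀ < s₁) (ht : t₀ < t₁)
    (hF : ContMDiffOn 𝓘(ℝ, ℝ × ℝ) 𝓘(ℝ, EP) ∞ F (Icc s₀ s₁ ×ˢ Icc t₀ t₁))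
    (hFΓ : EqOn (π ∘ F) Γ (Icc s₀ s₁ ×ˢ Icc t₀ t₁)) {u v : ℝ} (hu : u ∈ Icc s₀ s₁)
    (hv : v ∈ Icc t₀ t₁) :
    B (F (u, v)) (velocity EP t₀ t₁ (fun t => F (u, t)) v)
      (velocity EP s₀ s₁ (fun s => F (s, v)) u) = 0 := by
  let b : EP →L[ℝ] EP →L[ℝ] EH := B (F (u, v))
  let dπ : EP →L[ℝ] EM := mfderiv 𝓘(ℝ, EP) 𝓘(ℝ, EM) π (F (u, v))
  have hdep := hthin.not_linearIndependent_mfderiv_velocity hπ hs ht hF hFΓ hu hv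
  rw [LinearIndependent.pair_symm_iff] at hdep
  exact apply_eq_zero_of_not_linearIndependent_map
    (β := (ContinuousLinearMap.coeLM ℝ).comp b.toLinearMap) (hB.alternating _) dπ.toLinearMap
    (fun v hv => LinearMap.ext fun w => hB.vertical _ v w hv) hdep

theorem IsThin.omega_velocity_eq (hthin : IsThin EM s₀ s₁ t₀ t₁ Γ)
    (hB : IsHorizontalTwoForm EM π B)
    (hπ : ContMDiff 𝓘(ℝ, EP) 𝓘(ℝ, EM) ∞ π) (hs : s₀ < s₁) (ht : t₀ < t₁)
    (hF : ContMDiffOn 𝓘(ℝ, ℝ × ℝ) 𝓘(ℝ, EP) ∞ F (Icc s₀ s₁ ×ˢ Icc t₀ t₁))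
    (hFΓ : EqOn (π ∘ F) Γ (Icc s₀ s₁ ×ˢ Icc t₀ t₁)) {u : ℝ} (hu : u ∈ Icc s₀ s₁) :
    omega A B τ t₀ t₁ (fun v => F (u, v)) (fun v => velocity EP s₀ s₁ (fun s => F (s, v)) u) =
      A (F (u, t₀)) (velocity EP s₀ s₁ (fun s => F (s, t₀)) u) := by
  have hint : (∫ t in t₀..t₁, (B (F (u, t)) (velocity EP t₀ t₁ (fun t => F (u, t)) t)
      (velocity EP s₀ s₁ (fun s => F (s, t)) u) : EH) : EH) = 0 := by
    rw [← intervalIntegral.integral_zero (a := t₀) (b := t₁)]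
    refine intervalIntegral.integral_congr fun t htt => ?_
    rw [uIcc_of_le ht.le] at htt
    exact hthin.twoForm_velocity_eq_zero hB hπ hs ht hF hFΓ hu htt
  exact add_eq_left.2 ((congrArg (lieMap (EG := EH) (EH := EG) τ) hint).trans (map_zero _))

theorem IsOmegaHorizontalLift.isHorizontalLift_left
    (h : IsOmegaHorizontalLift π Abar A B τ s₀ s₁ t₀ t₁ Γ F)
    (hthin : IsThin EM s₀ s₁ t₀ t₁ Γ) (hB : IsHorizontalTwoForm EM π B)
    (hπ : ContMDiff 𝓘(ℝ, EP) 𝓘(ℝ, EM) ∞ π) (hs : s₀ < s₁) (ht : t₀ < t₁) :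
    IsHorizontalLift π A s₀ s₁ (fun s => Γ (s, t₀)) (fun s => F (s, t₀)) := by
  have ht₀ : t₀ ∈ Icc t₀ t₁ := left_mem_Icc.2 ht.le
  refine ⟨⟨contMDiffOn_left h.smooth ht₀, fun u hu => ?_⟩, fun u hu => (h.lift u hu).2 t₀ ht₀⟩
  rw [← h.horizontal u hu]
  exact (hthin.omega_velocity_eq hB hπ hs ht h.smooth
    (fun z hz => (h.lift z.1 hz.1).2 z.2 hz.2) hu).symm

theorem IsHorizontalLiftOn.isOmegaHorizontalLift
    (h : IsHorizontalLiftOn Abar π (Icc s₀ s₁ ×ˢ Icc t₀ t₁) Γ F)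
    (hthin : IsThin EM s₀ s₁ t₀ t₁ Γ) (hB : IsHorizontalTwoForm EM π B)
    (hπ : ContMDiff 𝓘(ℝ, EP) 𝓘(ℝ, EM) ∞ π) (hs : s₀ < s₁) (ht : t₀ < t₁)
    (hleft : ∀ u ∈ Icc s₀ s₁, F (u, t₀) = F (s₀, t₀)) :
    IsOmegaHorizontalLift π Abar A B τ s₀ s₁ t₀ t₁ Γ F := by
  refine ⟨h.contMDiffOn, fun u hu => h.right ht hu, fun u hu => ?_⟩
  rw [hthin.omega_velocity_eq hB hπ hs ht h.contMDiffOn (fun z hz => (h z hz).2) hu]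
  have hvel : (velocity EP s₀ s₁ (fun s => F (s, t₀)) u : EP) = 0 :=
    (velocity_congr hleft hu).trans
      (congrArg (fun L : ℝ →L[ℝ] EP => L 1) (mfderivWithin_const (c := F (s₀, t₀))))
  exact (congrArg (A (F (u, t₀))) hvel).trans (map_zero _)

variable [LieGroup 𝓘(ℝ, EG) ∞ G] [MulAction Gᵐᵒᵖ P] [IsManifold 𝓘(ℝ, EP) ∞ P]

theorem IsHorizontalLiftOn.isThin
    (h : IsHorizontalLiftOn A π (Icc s₀ s₁ ×ˢ Icc t₀ t₁) Γ F) (hA : IsConnectionForm A)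
    (hπ : IsPrincipalBundle EG EM EP G π) (hs : s₀ < s₁) (ht : t₀ < t₁)
    (hthin : IsThin EM s₀ s₁ t₀ t₁ Γ) : IsThin EP s₀ s₁ t₀ t₁ F := fun u hu v hv =>
  hA.not_linearIndependent_of_horizontal hπ ((h.left hs hv).1.2 u hu) ((h.right ht hu).1.2 v hv)
    (hthin.not_linearIndependent_mfderiv_velocity hπ.smooth_proj hs ht h.contMDiffOn
      (fun z hz => (h z hz).2) hu hv)

theorem IsOmegaHorizontalLift.eqOn
    (h₁ : IsOmegaHorizontalLift π Abar A B τ s₀ s₁ t₀ t₁ Γ F₁)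
    (h₂ : IsOmegaHorizontalLift π Abar A B τ s₀ s₁ t₀ t₁ Γ F₂)
    (hthin : IsThin EM s₀ s₁ t₀ t₁ Γ) (hB : IsHorizontalTwoForm EM π B)
    (hπ : IsPrincipalBundle EG EM EP G π) (hA : IsConnectionForm A)
    (hAbar : IsConnectionForm Abar) (hs : s₀ < s₁) (ht : t₀ < t₁)
    (h : F₁ (s₀, t₀) = F₂ (s₀, t₀)) : EqOn F₁ F₂ (Icc s₀ s₁ ×ˢ Icc t₀ t₁) := by
  have hleft := (h₁.isHorizontalLift_left hthin hB hπ.smooth_proj hs ht).eqOn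
    (h₂.isHorizontalLift_left hthin hB hπ.smooth_proj hs ht) hA hπ hs h
  exact fun z hz => (h₁.lift z.1 hz.1).eqOn (h₂.lift z.1 hz.1) hAbar hπ ht (hleft hz.1) hz.2

end OmegaHorizontal

end PathConn

theorem theoremT_general
    {EG EH EM EP : Type*}
    [NormedAddCommGroup EG] [NormedSpace ℝ EG] [CompleteSpace EG]
    [NormedAddCommGroup EH] [NormedSpace ℝ EH] [NormedAddCommGroup EM] [NormedSpace ℝ EM]
    [NormedAddCommGroup EP] [NormedSpace ℝ EP]
    {G : Type*} [TopologicalSpace G] [ChartedSpace EG G] [Group G] [LieGroup 𝓘(ℝ, EG) ∞ G]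
    {H : Type*} [TopologicalSpace H] [ChartedSpace EH H] [Group H]
    {M : Type*} [TopologicalSpace M] [ChartedSpace EM M]
    {P : Type*} [TopologicalSpace P] [ChartedSpace EP P] [IsManifold 𝓘(ℝ, EP) ∞ P]
    [MulAction Gᵐᵒᵖ P]
    (τ : H →* G) {π : P → M} (hπ : IsPrincipalBundle EG EM EP G π)
    {A Abar : ∀ p : P, TangentSpace 𝓘(ℝ, EP) p →L[ℝ] GroupLieAlgebra 𝓘(ℝ, EG) G}
    (hA : IsConnectionForm A) (hAbar : IsConnectionForm Abar)
    {B : ∀ p : P, TangentSpace 𝓘(ℝ, EP) p →L[ℝ] TangentSpace 𝓘(ℝ, EP) p →L[ℝ]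
      GroupLieAlgebra 𝓘(ℝ, EH) H}
    (hB : IsHorizontalTwoForm EM π B)
    {s₀ s₁ t₀ t₁ : ℝ} (hs : s₀ < s₁) (ht : t₀ < t₁) {Γ : ℝ × ℝ → M}
    (hΓ : ContMDiffOn 𝓘(ℝ, ℝ × ℝ) 𝓘(ℝ, EM) ∞ Γ (Icc s₀ s₁ ×ˢ Icc t₀ t₁))
    (hthin : IsThin EM s₀ s₁ t₀ t₁ Γ)
    (hleft : ∀ u ∈ Icc s₀ s₁, Γ (u, t₀) = Γ (s₀, t₀))
    (hright : ∀ u ∈ Icc s₀ s₁, Γ (u, t₁) = Γ (s₀, t₁))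
    {γ₀ : ℝ → P} (hγ₀ : IsHorizontalLift π Abar t₀ t₁ (fun v => Γ (s₀, v)) γ₀) :
    ∃ Γt : ℝ × ℝ → P,
      (∀ u ∈ Icc s₀ s₁,
        IsHorizontalLift π Abar t₀ t₁ (fun v => Γ (u, v)) (fun v => Γt (u, v)) ∧
        Γt (u, t₀) = γ₀ t₀ ∧
        ∀ γ : ℝ → P, IsHorizontalLift π Abar t₀ t₁ (fun v => Γ (u, v)) γ → γ t₀ = γ₀ t₀ →
          EqOn γ (fun v => Γt (u, v)) (Icc t₀ t₁)) ∧
      IsOmegaHorizontalLift π Abar A B τ s₀ s₁ t₀ t₁ Γ Γt ∧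
      EqOn (fun v => Γt (s₀, v)) γ₀ (Icc t₀ t₁) ∧
      (∀ Γt' : ℝ × ℝ → P, IsOmegaHorizontalLift π Abar A B τ s₀ s₁ t₀ t₁ Γ Γt' →
        EqOn (fun v => Γt' (s₀, v)) γ₀ (Icc t₀ t₁) →
        EqOn Γt' Γt (Icc s₀ s₁ ×ˢ Icc t₀ t₁)) ∧
      IsThin EP s₀ s₁ t₀ t₁ Γt ∧
      (∀ u ∈ Icc s₀ s₁, Γt (u, t₁) = γ₀ t₁) := by
  have ht₀ : t₀ ∈ Icc t₀ t₁ := left_mem_Icc.2 ht.le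
  have ht₁ : t₁ ∈ Icc t₀ t₁ := right_mem_Icc.2 ht.le
  obtain ⟨F, hF, hF₀⟩ := hthin.exists_horizontalLiftOn hΓ hAbar hπ hs ht (hγ₀.2 t₀ ht₀)
  have hinit : EqOn (fun v => F (s₀, v)) γ₀ (Icc t₀ t₁) :=
    (hF.right ht (left_mem_Icc.2 hs.le)).eqOn hγ₀ hAbar hπ ht hF₀
  have hFleft : ∀ u ∈ Icc s₀ s₁, F (u, t₀) = F (s₀, t₀) := fun u hu =>
    (hF.left hs ht₀).eq_of_const hAbar hπ hs hleft hu
  have hFright : ∀ u ∈ Icc s₀ s₁, F (u, t₁) = F (s₀, t₁) := fun u hu =>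
    (hF.left hs ht₁).eq_of_const hAbar hπ hs hright hu
  have hOmega : IsOmegaHorizontalLift π Abar A B τ s₀ s₁ t₀ t₁ Γ F :=
    hF.isOmegaHorizontalLift hthin hB hπ.smooth_proj hs ht hFleft
  refine ⟨F, fun u hu => ⟨hF.right ht hu, (hFleft u hu).trans hF₀, fun γ hγ h => ?_⟩,
    hOmega, hinit, fun F' hF' h => ?_, hF.isThin hAbar hπ hs ht hthin,
    fun u hu => (hFright u hu).trans (hinit ht₁)⟩
  · exact hγ.eqOn (hF.right ht hu) hAbar hπ ht (h.trans ((hFleft u hu).trans hF₀).symm)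
  · exact hF'.eqOn hOmega hthin hB hπ hA hAbar hs ht ((h ht₀).trans hF₀.symm)

theorem theoremT
    {EG EH EM EP : Type*}
    [NormedAddCommGroup EG] [NormedSpace ℝ EG] [FiniteDimensional ℝ EG]
    [NormedAddCommGroup EH] [NormedSpace ℝ EH] [FiniteDimensional ℝ EH]
    [NormedAddCommGroup EM] [NormedSpace ℝ EM] [FiniteDimensional ℝ EM]
    [NormedAddCommGroup EP] [NormedSpace ℝ EP] [FiniteDimensional ℝ EP]
    {G : Type*} [TopologicalSpace G] [T2Space G] [ChartedSpace EG G] [Group G]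
    [LieGroup 𝓘(ℝ, EG) ∞ G]
    {H : Type*} [TopologicalSpace H] [T2Space H] [ChartedSpace EH H] [Group H]
    [LieGroup 𝓘(ℝ, EH) ∞ H]
    {M : Type*} [TopologicalSpace M] [T2Space M] [ChartedSpace EM M]
    [IsManifold 𝓘(ℝ, EM) ∞ M]
    {P : Type*} [TopologicalSpace P] [T2Space P] [ChartedSpace EP P]
    [IsManifold 𝓘(ℝ, EP) ∞ P] [MulAction Gᵐᵒᵖ P]
    (α : G →* MulAut H) (τ : H →* G) (hατ : IsLieCrossedModule EG EH α τ)
    (π : P → M) (hπ : IsPrincipalBundle EG EM EP G π)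
    (A Abar : ∀ p : P, TangentSpace 𝓘(ℝ, EP) p →L[ℝ] GroupLieAlgebra 𝓘(ℝ, EG) G)
    (hA : IsConnectionForm A) (hAbar : IsConnectionForm Abar)
    (B : ∀ p : P, TangentSpace 𝓘(ℝ, EP) p →L[ℝ] TangentSpace 𝓘(ℝ, EP) p →L[ℝ]
      GroupLieAlgebra 𝓘(ℝ, EH) H)
    (hB : IsEquivariantTwoForm EM π α B)
    (s₀ s₁ t₀ t₁ : ℝ) (hs : s₀ < s₁) (ht : t₀ < t₁)
    (Γ : ℝ × ℝ → M)
    (hΓ : ContMDiffOn 𝓘(ℝ, ℝ × ℝ) 𝓘(ℝ, EM) ∞ Γ (Icc s₀ s₁ ×ˢ Icc t₀ t₁))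
    (hthin : IsThin EM s₀ s₁ t₀ t₁ Γ)
    (hleft : ∀ u ∈ Icc s₀ s₁, Γ (u, t₀) = Γ (s₀, t₀))
    (hright : ∀ u ∈ Icc s₀ s₁, Γ (u, t₁) = Γ (s₀, t₁))
    (γ₀ : ℝ → P) (hγ₀ : IsHorizontalLift π Abar t₀ t₁ (fun v => Γ (s₀, v)) γ₀) :
    ∃ Γt : ℝ × ℝ → P,
      -- each `Γt (u, ·)` is the `Abar`-horizontal lift of `Γ (u, ·)` with initial point `γ₀ t₀`
      (∀ u ∈ Icc s₀ s₁,
        IsHorizontalLift π Abar t₀ t₁ (fun v => Γ (u, v)) (fun v => Γt (u, v)) ∧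
        Γt (u, t₀) = γ₀ t₀ ∧
        ∀ γ : ℝ → P, IsHorizontalLift π Abar t₀ t₁ (fun v => Γ (u, v)) γ → γ t₀ = γ₀ t₀ →
          EqOn γ (fun v => Γt (u, v)) (Icc t₀ t₁)) ∧
      -- `Γt` is the `ω_(A,B)`-horizontal lift of `Γ` with initial path `γ₀`
      IsOmegaHorizontalLift π Abar A B τ s₀ s₁ t₀ t₁ Γ Γt ∧
      EqOn (fun v => Γt (s₀, v)) γ₀ (Icc t₀ t₁) ∧
      (∀ Γt' : ℝ × ℝ → P, IsOmegaHorizontalLift π Abar A B τ s₀ s₁ t₀ t₁ Γ Γt' →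
        EqOn (fun v => Γt' (s₀, v)) γ₀ (Icc t₀ t₁) →
        EqOn Γt' Γt (Icc s₀ s₁ ×ˢ Icc t₀ t₁)) ∧
      -- `Γt` is thin and keeps the end points fixed
      IsThin EP s₀ s₁ t₀ t₁ Γt ∧
      (∀ u ∈ Icc s₀ s₁, Γt (u, t₁) = γ₀ t₁) :=
  have := FiniteDimensional.complete ℝ EG
  theoremT_general τ hπ hA hAbar ⟨hB.alternating, hB.vertical⟩ hs ht hΓ hthin hleft hright hγ₀
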